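/- Let $q$ be a prime power and let $1\le n\le \ell$ be integers. Let $e_1,\dots,e_{n+\ell}$ be the standard basis of $\mathbb{F}_q^{n+\ell}$ and $E=\langle e_{n+1},\dots,e_{n+\ell}\rangle$. For $m\in\{1,\dots,n\}$ let ${\cal M}_m$ be the set of $m$-dimensional subspaces of $\mathbb{F}_q^{n+\ell}$ that meet $E$ only in $0$. Call two subspaces disjoint if their intersection is $0$. Let $M$ be the real $0/1$ incidence matrix with rows indexed by ${\cal M}_1$ and columns indexed by ${\cal M}_n$, whose $(\tau,\pi)$ entry is $1$ if and only if $\tau\subseteq\pi$. Let $K$ be the adjacency matrix of the graph on ${\cal M}_n$ in which two vertices are adjacent when they are disjoint. For $j=0,1$ let $V_j\subseteq\mathbb{R}^{{\cal M}_n}$ be the eigenspace of $K$ for the eigenvalue $$\lambda_j=(-1)^jq^{\binom n2}\prod_{s=1}^{n-j}(q^{\ell-n+s}-1).$$ For ${\cal L}\subseteq{\cal M}_n$ let $\chi_{\cal L}\in\{0,1\}^{{\cal M}_n}$ be its characteristic vector, with $(\chi_{\cal L})_\pi$ the entry at $\pi\in{\cal M}_n$, and let ${\rm j}\in\mathbb{R}^{{\cal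 M}_n}$ be the all-one vector. A partition of $\mathbb{F}_q^{n+\ell}$ is a set ${\cal P}$ of subspaces such that every one-dimensional subspace is contained in exactly one member of ${\cal P}$. An attenuated $n$-spread is a set of the form ${\cal P}\setminus\{E\}$, where ${\cal P}$ is a partition of $\mathbb{F}_q^{n+\ell}$ with $E\in{\cal P}$ whose set of dimensions of members is exactly $\{n,\ell\}$ (so $\{n\}$ if $n=\ell$). An attenuated partial $n$-spread is a subset of an attenuated $n$-spread. A pair of conjugate switching sets is a pair of disjoint attenuated partial $n$-spreads ${\cal R},{\cal R}'$ such that the set of elements of ${\cal M}_1$ contained in some member of ${\cal R}$ equals the set of elements of ${\cal M}_1$ contained in some member of ${\cal R}'$. **Theorem.** Let ${\cal L}\subseteq{\cal M}_n$ be non-empty with $|{\cal L}|=xq^{(n-1)\ell}$, where $x$ is an integer. Then the following are equivalent. (i) $\chi_{\cal L}\in{\rm Im}(M^t)$. (ii) $\chi_{\cal L}\in\ker(M)^\perp$, the orthogonal complement being taken for the standard inner product on $\mathbb{R}^{{\cal M}_n}$. (iii) For every $\pi\in{\cal M}_n$, the number of elements of ${\cal L}$ disjoint from $\pi$ is $$(x-(\chi_{\cal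 L})_\pi)\,q^{\binom n2}\prod_{s=1}^{n-1}(q^{\ell-n+s}-1).$$ (iv) $\chi_{\cal L}-xq^{-\ell}{\rm j}\in V_1$. (v) $\chi_{\cal L}\in V_0\oplus V_1$. (vi) $|{\cal L}\cap{\cal S}|=x$ for every attenuated $n$-spread ${\cal S}$. (vii) $|{\cal L}\cap{\cal R}|=|{\cal L}\cap{\cal R}'|$ for every pair of conjugate switching sets ${\cal R},{\cal R}'$. -/

import Mathlib

namespace CameronLiebler

open scoped Matrix

noncomputable section

/-- The column space `F ^ (n + ℓ)`. -/
abbrev Space (F : Type*) (n ℓ : ℕ) : Type _ := Fin (n + ℓ) → F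

section Geometry

variable (F : Type*) [Field F] (n ℓ : ℕ)

/-- `E = ⟨e_{n+1}, …, e_{n+ℓ}⟩`, the span of the last `ℓ` standard basis vectors. -/
def E : Submodule F (Space F n ℓ) :=
  Submodule.span F (Set.range fun i : Fin ℓ => Pi.single (Fin.natAdd n i) (1 : F))

/-- The set `𝓜(m, k; n + ℓ, E)` of the subspaces of type `(m, k)`: those of dimension `m` whose
intersection with `E` has dimension `k`. -/
def subspacesOfType (m k : ℕ) : Set (Submodule F (Space F n ℓ)) :=
  {P | Module.finrank F P = m ∧ Module.finrank F (P ⊓ E F n ℓ : Submodule F (Space F n ℓ)) = k}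

/-- `𝓜_m = 𝓜(m, 0; n + ℓ, E)`, the `m`-dimensional members of the attenuated space. -/
def attenuated (m : ℕ) : Set (Submodule F (Space F n ℓ)) :=
  subspacesOfType F n ℓ m 0

instance [Finite F] (m : ℕ) : Fintype (attenuated F n ℓ m) := Fintype.ofFinite _

variable {F n ℓ}

/-- A partition of the vector space: every one-dimensional subspace lies in exactly one member. -/
def IsPartition (P : Set (Submodule F (Space F n ℓ))) : Prop :=
  ∀ τ : Submodule F (Space F n ℓ), Module.finrank F τ = 1 → ∃! W, W ∈ P ∧ τ ≤ W

/-- A `T`-partition: a partition whose set of dimensions of members is `T`. -/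
def IsTPartition (T : Set ℕ) (P : Set (Submodule F (Space F n ℓ))) : Prop :=
  IsPartition P ∧ (fun W : Submodule F (Space F n ℓ) => Module.finrank F W) '' P = T

/-- An attenuated `n`-spread: a set `P \ {E}`, where `P` contains `E` and is an `{ℓ, n}`-partition
(which means an `n`-spread if `n = ℓ`). -/
def IsAttenuatedSpread (S : Set (Submodule F (Space F n ℓ))) : Prop :=
  ∃ P : Set (Submodule F (Space F n ℓ)),
    E F n ℓ ∈ P ∧ IsTPartition {ℓ, n} P ∧ S = P \ {E F n ℓ}

/-- An attenuated partial `n`-spread: a subset of an attenuated `n`-spread. -/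
def IsAttenuatedPartialSpread (R : Set (Submodule F (Space F n ℓ))) : Prop :=
  ∃ S, IsAttenuatedSpread S ∧ R ⊆ S

/-- The set of the elements of `𝓜_1` that are contained in some member of `R`. -/
def coveredPoints (R : Set (Submodule F (Space F n ℓ))) : Set (Submodule F (Space F n ℓ)) :=
  {τ | τ ∈ attenuated F n ℓ 1 ∧ ∃ ρ ∈ R, τ ≤ ρ}

/-- A pair of conjugate switching sets. -/
def AreConjugateSwitchingSets (R R' : Set (Submodule F (Space F n ℓ))) : Prop :=
  IsAttenuatedPartialSpread R ∧ IsAttenuatedPartialSpread R' ∧ Disjoint R R' ∧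
    coveredPoints R = coveredPoints R'

open Classical in
/-- The characteristic vector `χ_L`, with coordinates indexed by `𝓜_n`. -/
def charVec (L : Set (Submodule F (Space F n ℓ))) : attenuated F n ℓ n → ℝ :=
  fun π => if (π : Submodule F (Space F n ℓ)) ∈ L then 1 else 0

end Geometry

section Algebra

variable (F : Type*) [Field F] (n ℓ : ℕ)

open Classical in
/-- The incidence matrix of `𝓜_1` (rows) versus `𝓜_n` (columns). -/
def incMatrix : Matrix (attenuated F n ℓ 1) (attenuated F n ℓ n) ℝ :=
  fun τ π => if (τ : Submodule F (Space F n ℓ)) ≤ π then 1 else 0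

/-- The attenuated `q`-Kneser graph on `𝓜_n`: two (distinct) vertices are adjacent when they meet
only in the zero vector. -/
def kneserGraph : SimpleGraph (attenuated F n ℓ n) where
  Adj π σ := π ≠ σ ∧ Disjoint (π : Submodule F (Space F n ℓ)) (σ : Submodule F (Space F n ℓ))
  symm := ⟨fun _ _ h => ⟨h.1.symm, h.2.symm⟩⟩
  loopless := ⟨fun _ h => h.1 rfl⟩

open Classical in
/-- The adjacency matrix `K` of the attenuated `q`-Kneser graph. -/
def kneserMatrix : Matrix (attenuated F n ℓ n) (attenuated F n ℓ n) ℝ :=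
  (kneserGraph F n ℓ).adjMatrix ℝ

/-- `λ_j = (-1)^j q^{n(n-1)/2} ∏_{s=1}^{n-j} (q^{ℓ-n+s} - 1)` (for `j ≤ n ≤ ℓ`). -/
def eigval (j : ℕ) : ℝ :=
  (-1) ^ j * (Nat.card F : ℝ) ^ n.choose 2 *
    ∏ s ∈ Finset.Icc 1 (n - j), ((Nat.card F : ℝ) ^ (ℓ - n + s) - 1)

/-- `V_j`, the eigenspace of `K` for `λ_j`. -/
def eigSpace [Finite F] (j : ℕ) : Submodule ℝ (attenuated F n ℓ n → ℝ) :=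
  Module.End.eigenspace (kneserMatrix F n ℓ).mulVecLin (eigval F n ℓ j)

/-- The sum `V_0 + V_1` is direct. -/
theorem disjoint_eigSpace [Finite F] :
    Disjoint (eigSpace F n ℓ 0) (eigSpace F n ℓ 1) := by
  have hq : (1 : ℝ) < (Nat.card F : ℝ) := by exact_mod_cast Finite.one_lt_card
  have hp : ∀ m : ℕ, 0 < ∏ s ∈ Finset.Icc 1 m, ((Nat.card F : ℝ) ^ (ℓ - n + s) - 1) := by
    intro m
    refine Finset.prod_pos fun s hs => sub_pos.2 (one_lt_pow₀ hq ?_)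
    have := (Finset.mem_Icc.1 hs).1
    omega
  have hc : 0 < (Nat.card F : ℝ) ^ n.choose 2 := by positivity
  have h0 : 0 < eigval F n ℓ 0 := by
    have := mul_pos hc (hp (n - 0))
    simpa [eigval] using this
  have h1 : eigval F n ℓ 1 < 0 := by
    have := mul_pos hc (hp (n - 1))
    simp only [eigval, pow_one]
    linarith
  exact (Module.End.eigenspaces_iSupIndep _).pairwiseDisjoint (h1.trans h0).ne'

/-- The orthogonal complement of `U` for the standard inner product on `ℝ ^ ι`. -/
def orthCompl {ι : Type*} [Fintype ι] (U : Submodule ℝ (ι → ℝ)) : Submodule ℝ (ι → ℝ) where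
  carrier := {v | ∀ u ∈ U, u ⬝ᵥ v = 0}
  add_mem' ha hb u hu := by rw [dotProduct_add, ha u hu, hb u hu, add_zero]
  zero_mem' u _ := dotProduct_zero u
  smul_mem' c v hv u hu := by rw [dotProduct_smul, hv u hu, smul_zero]

end Algebra

end

end CameronLiebler

/-! Sending an `n × ℓ` matrix `A` to the space of vectors `(u, uA)` identifies `𝓜_n` with the
additive group of matrices. Two such spaces are disjoint exactly when the difference of their
matrices has rank `n`, so `K` is convolution with the set of rank-`n` matrices and the additive
characters, indexed by matrices `C`, diagonalize it.

The deep implication is (v) → (ii), which rests on two vanishing statements. At every `C` of rank at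
least two the eigenvalue differs from `λ_0` and `λ_1` (`indepCharSum_ne_eigval`), so transforms of
vectors in `V_0` or `V_1` vanish there. A vector in `ker M` has zero sum over the matrices with `uA
= w`, for each `u ≠ 0` and each `w`, so its transform vanishes at every `C` of rank at most one
(`matHat_eq_zero_of_sum_eq_zero`). Parseval then gives orthogonality.

The rest closes the cycle (ii) → (vii) → (vi) → (iii) → (iv) → (v). Conjugate switching sets have
characteristic vectors with the same image under `M`. The two differences of any two attenuated
spreads are conjugate, so (vii) makes the intersection number constant, and averaging over the
translates of one spread, built from multiplication in the field with `q^ℓ` elements, shows that it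
is `x`. Averaging over the images of that spread under `GL(ℓ, q)` turns (vi) into the count (iii)
(`rankConv_of_sum_regular_family`), which is the eigenvector equation (iv) up to a constant. Finally
(i) ↔ (ii) is linear algebra. -/

namespace CameronLiebler

open scoped Matrix

noncomputable section

/-! ### Character sums over linearly independent tuples -/

section CharacterSums

open Classical in
/-- The sum of the additive character `ψ` over the linearly independent tuples in `V`, twisted by a
tuple `c` of linear functionals. -/
def indepCharSum {F V : Type*} [Field F] [AddCommGroup V] [Module F V] [Fintype V]
    (ψ : AddChar F ℂ) {m : ℕ} (c : Fin m → Module.Dual F V) : ℂ :=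
  ∑ a : Fin m → V, if LinearIndependent F a then ψ (∑ i, c i (a i)) else 0

variable {F V : Type*} [Field F] [AddCommGroup V] [Module F V] [Fintype V] {ψ : AddChar F ℂ}

theorem sum_char_dual_eq_zero (hψ : ψ ≠ 0) {c : Module.Dual F V} (hc : c ≠ 0) :
    ∑ a : V, ψ (c a) = 0 := by
  have h : ψ.compAddMonoidHom c.toAddMonoidHom ≠ 0 := by
    intro h0
    apply hψ
    ext x
    obtain ⟨a, rfl⟩ := LinearMap.surjective hc x
    simpa using DFunLike.congr_fun h0 a
  simpa using AddChar.sum_eq_zero_iff_ne_zero.2 h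

open Classical in
theorem sum_char_submodule (hψ : ψ ≠ 0) (W : Submodule F V) (c : Module.Dual F V) :
    ∑ a : V, (if a ∈ W then ψ (c a) else 0) =
      if W ≤ LinearMap.ker c then (Nat.card W : ℂ) else 0 := by
  have h1 : ∑ a : V, (if a ∈ W then ψ (c a) else 0) = ∑ a : W, ψ (c.domRestrict W a) := by
    rw [← Finset.sum_filter]
    refine Finset.sum_subtype _ (by simp) (fun a => ψ (c a))
  rw [h1]
  split_ifs with h
  · have : ∀ a : W, ψ (c.domRestrict W a) = 1 := fun a => by
      have : c a = 0 := h a.2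
      simp [this]
    simp only [this]
    simp
  · refine sum_char_dual_eq_zero hψ fun h0 => h fun a ha => ?_
    simpa using DFunLike.congr_fun h0 ⟨a, ha⟩

-- The sum over all of `U` vanishes because `c` is nontrivial on `U`, so only minus the sum over `W`
-- is left.
open Classical in
theorem sum_char_compl_submodule (hψ : ψ ≠ 0) (W U : Submodule F V) (hWU : W ≤ U)
    (c : Module.Dual F V) (hc : ¬ U ≤ LinearMap.ker c) :
    ∑ a : V, (if a ∈ U ∧ a ∉ W then ψ (c a) else 0) =
      if W ≤ LinearMap.ker c then -(Nat.card W : ℂ) else 0 := by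
  have h := sum_char_submodule hψ U c
  rw [if_neg hc] at h
  have h2 := sum_char_submodule hψ W c
  have h3 : ∑ a : V, (if a ∈ U ∧ a ∉ W then ψ (c a) else 0) =
      ∑ a : V, (if a ∈ U then ψ (c a) else 0) - ∑ a : V, (if a ∈ W then ψ (c a) else 0) := by
    rw [← Finset.sum_sub_distrib]
    refine Finset.sum_congr rfl fun a _ => ?_
    by_cases hW : a ∈ W
    · simp [hW, hWU hW]
    · simp [hW]
  rw [h3, h, h2]
  split_ifs <;> simp

variable [Fintype F]

-- Summing over `a₀` first gives `-q^(dim W + 1)` and forces `W` and `a₁` into `ker c₀`. The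
-- remaining sum over `a₁ ∈ ker c₀ \ W` gives `-q^(dim W)` and forces `W ≤ ker c₁`.
open Classical in
theorem sum_char_pair (hψ : ψ ≠ 0) (W : Submodule F V) (c₀ c₁ : Module.Dual F V)
    (h₁ : ¬ LinearMap.ker c₀ ≤ LinearMap.ker c₁) (h₀ : c₀ ≠ 0) :
    ∑ a₁ : V, ∑ a₀ : V, (if a₁ ∉ W ∧ a₀ ∉ W ⊔ Submodule.span F {a₁} then
        ψ (c₀ a₀ + c₁ a₁) else 0) =
      if W ≤ LinearMap.ker c₀ ⊓ LinearMap.ker c₁ then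
        (Nat.card F : ℂ) ^ (2 * Module.finrank F W + 1) else 0 := by
  have hinner : ∀ a₁ : V, ∑ a₀ : V, (if a₁ ∉ W ∧ a₀ ∉ W ⊔ Submodule.span F {a₁} then
        ψ (c₀ a₀ + c₁ a₁) else 0) =
      if W ≤ LinearMap.ker c₀ then
        -(Nat.card F : ℂ) ^ (Module.finrank F W + 1) *
          (if a₁ ∈ LinearMap.ker c₀ ∧ a₁ ∉ W then ψ (c₁ a₁) else 0) else 0 := by
    intro a₁
    by_cases ha : a₁ ∈ W
    · simp [ha]
    have ha0 : a₁ ≠ 0 := by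
      rintro rfl
      exact ha W.zero_mem
    have h := sum_char_compl_submodule hψ (W ⊔ Submodule.span F {a₁}) ⊤ le_top c₀
      (fun h => h₀ (LinearMap.ker_eq_top.1 (top_le_iff.1 h)))
    have hcard : Nat.card (W ⊔ Submodule.span F {a₁} : Submodule F V) =
        Nat.card F ^ (Module.finrank F W + 1) := by
      rw [Module.natCard_eq_pow_finrank (K := F)]
      congr 1
      have hd : Disjoint W (Submodule.span F {a₁}) := by
        rw [Submodule.disjoint_span_singleton' ha0]
        exact ha
      have := Submodule.finrank_sup_add_finrank_inf_eq W (Submodule.span F {a₁})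
      rw [hd.eq_bot, finrank_bot, finrank_span_singleton ha0] at this
      simpa using this
    simp only [ha, not_false_eq_true, true_and, Submodule.mem_top, and_true] at h ⊢
    have h3 : ∑ a₀ : V, (if a₀ ∉ W ⊔ Submodule.span F {a₁} then ψ (c₀ a₀ + c₁ a₁) else 0) =
        (∑ a₀ : V, if a₀ ∉ W ⊔ Submodule.span F {a₁} then ψ (c₀ a₀) else 0) * ψ (c₁ a₁) := by
      rw [Finset.sum_mul]
      refine Finset.sum_congr rfl fun a₀ _ => ?_
      split_ifs <;> simp [AddChar.map_add_eq_mul]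
    rw [h3, h, hcard]
    simp only [sup_le_iff, Submodule.span_singleton_le_iff_mem]
    by_cases hW : W ≤ LinearMap.ker c₀ <;> by_cases hk : a₁ ∈ LinearMap.ker c₀ <;>
      simp [hW, hk]
  simp only [hinner]
  by_cases hW : W ≤ LinearMap.ker c₀
  · simp only [hW, if_true, le_inf_iff, true_and]
    rw [← Finset.mul_sum, sum_char_compl_submodule hψ W _ hW c₁ h₁,
      Module.natCard_eq_pow_finrank (K := F) (V := W)]
    split_ifs
    · push_cast; ring
    · simp
  · simp [hW]

-- A tuple is independent when its tail is and the two leading vectors successively avoid the spans.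
-- Those two vectors are summed out with `sum_char_pair`, which confines the tail to a space of
-- codimension two.
open Classical in
theorem indepCharSum_cons_cons (hψ : ψ ≠ 0) {k : ℕ} (c : Fin k → Module.Dual F V)
    (c₀ c₁ : Module.Dual F V) (h₁ : ¬ LinearMap.ker c₀ ≤ LinearMap.ker c₁) (h₀ : c₀ ≠ 0) :
    indepCharSum ψ (Fin.cons c₀ (Fin.cons c₁ c : Fin (k + 1) → Module.Dual F V)) =
      (Nat.card F : ℂ) ^ (2 * k + 1) *
        ∑ a : Fin k → V, if LinearIndependent F a ∧
            ∀ i, a i ∈ LinearMap.ker c₀ ⊓ LinearMap.ker c₁ then ψ (∑ i, c i (a i)) else 0 := by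
  have hcons : ∀ (m : ℕ) (f : (Fin (m + 1) → V) → ℂ),
      ∑ a, f a = ∑ a : Fin m → V, ∑ b : V, f (Fin.cons b a) := by
    intro m f
    rw [← (Fin.consEquiv fun _ => V).sum_comp, Fintype.sum_prod_type, Finset.sum_comm]
    rfl
  unfold indepCharSum
  rw [hcons, hcons, Finset.mul_sum]
  refine Finset.sum_congr rfl fun a _ => ?_
  by_cases ha : LinearIndependent F a
  · have h := sum_char_pair hψ (Submodule.span F (Set.range a)) c₀ c₁ h₁ h₀
    have hfr : Module.finrank F (Submodule.span F (Set.range a)) = k := by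
      simpa using finrank_span_eq_card ha
    have hle : Submodule.span F (Set.range a) ≤ LinearMap.ker c₀ ⊓ LinearMap.ker c₁ ↔
        ∀ i, a i ∈ LinearMap.ker c₀ ⊓ LinearMap.ker c₁ := by
      rw [Submodule.span_le, Set.range_subset_iff]; rfl
    rw [hfr, if_congr hle rfl rfl] at h
    have hli : ∀ a₁ a₀ : V, LinearIndependent F
        (Fin.cons a₀ (Fin.cons a₁ a : Fin (k + 1) → V) : Fin (k + 2) → V) ↔
        a₁ ∉ Submodule.span F (Set.range a) ∧
          a₀ ∉ Submodule.span F (Set.range a) ⊔ Submodule.span F {a₁} := by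
      intro a₁ a₀
      rw [linearIndependent_finCons, linearIndependent_finCons, Fin.range_cons,
        Submodule.span_insert, sup_comm]
      tauto
    simp only [hli, Fin.sum_univ_succ, Fin.cons_zero, Fin.cons_succ, ← add_assoc, ha, true_and]
    simp only [AddChar.map_add_eq_mul ψ _ (∑ i, c i (a i))]
    have h3 : ∀ a₁ a₀ : V, (if a₁ ∉ Submodule.span F (Set.range a) ∧
          a₀ ∉ Submodule.span F (Set.range a) ⊔ Submodule.span F {a₁} then
          ψ (c₀ a₀ + c₁ a₁) * ψ (∑ i, c i (a i)) else 0) =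
        (if a₁ ∉ Submodule.span F (Set.range a) ∧
          a₀ ∉ Submodule.span F (Set.range a) ⊔ Submodule.span F {a₁} then
          ψ (c₀ a₀ + c₁ a₁) else 0) * ψ (∑ i, c i (a i)) := by
      intro a₁ a₀; rw [ite_mul, zero_mul]
    simp only [h3, ← Finset.sum_mul, h]
    split_ifs <;> simp
  · have hli : ∀ a₁ a₀ : V, ¬ LinearIndependent F
        (Fin.cons a₀ (Fin.cons a₁ a : Fin (k + 1) → V) : Fin (k + 2) → V) := by
      intro a₁ a₀ h
      rw [linearIndependent_finCons, linearIndependent_finCons] at h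
      exact ha h.1.1
    simp [hli, ha]

-- By the triangle inequality, the sum over the tail is at most the number of independent `k`-tuples
-- in `ker c₀ ⊓ ker c₁`, whose dimension is `d`.
open Classical in
theorem norm_indepCharSum_cons_cons_le (hψ : ψ ≠ 0) {k d : ℕ} (hkd : k ≤ d)
    (hd : Module.finrank F V = d + 2) (c : Fin k → Module.Dual F V)
    (c₀ c₁ : Module.Dual F V) (h₁ : ¬ LinearMap.ker c₀ ≤ LinearMap.ker c₁) (h₀ : c₀ ≠ 0) :
    ‖indepCharSum ψ (Fin.cons c₀ (Fin.cons c₁ c : Fin (k + 1) → Module.Dual F V))‖ ≤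
      (Nat.card F : ℝ) ^ (2 * k + 1) *
        ∏ i ∈ Finset.range k, ((Nat.card F : ℝ) ^ d - (Nat.card F : ℝ) ^ i) := by
  rw [indepCharSum_cons_cons hψ c c₀ c₁ h₁ h₀, norm_mul]
  have hn : ‖(Nat.card F : ℂ) ^ (2 * k + 1)‖ = (Nat.card F : ℝ) ^ (2 * k + 1) := by
    rw [norm_pow, Complex.norm_natCast]
  rw [hn]
  refine mul_le_mul_of_nonneg_left ?_ (by positivity)
  set U := LinearMap.ker c₀ ⊓ LinearMap.ker c₁ with hU
  have hUd : Module.finrank F U = d := by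
    have e1 := Module.Dual.finrank_ker_add_one_of_ne_zero (K := F) h₀
    have hc : c₁.domRestrict (LinearMap.ker c₀) ≠ 0 := fun h0 =>
      h₁ fun a ha => by simpa using DFunLike.congr_fun h0 ⟨a, ha⟩
    have e2 := Module.Dual.finrank_ker_add_one_of_ne_zero (K := F) hc
    have e3 : Module.finrank F (LinearMap.ker (c₁.domRestrict (LinearMap.ker c₀))) =
        Module.finrank F U := by
      rw [LinearMap.ker_domRestrict, hU, inf_comm]
      have := Submodule.finrank_map_subtype_eq (LinearMap.ker c₀)
        ((LinearMap.ker c₁).comap (LinearMap.ker c₀).subtype)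
      rw [Submodule.map_comap_subtype, inf_comm] at this
      exact this.symm
    omega
  calc _ ≤ ∑ a : Fin k → V, if LinearIndependent F a ∧ ∀ i, a i ∈ U then (1 : ℝ) else 0 := by
        refine (norm_sum_le _ _).trans (Finset.sum_le_sum fun a _ => ?_)
        split_ifs <;> simp
    _ = (Nat.card {s : Fin k → U // LinearIndependent F s} : ℝ) := by
        rw [Finset.sum_boole, Nat.cast_inj, Nat.card_eq_fintype_card, Fintype.card_subtype]
        symm
        refine Finset.card_bij (fun s _ i => (s i : V)) ?_ ?_ ?_
        · intro s hs
          simp only [Finset.mem_filter, Finset.mem_univ, true_and] at hs ⊢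
          exact ⟨hs.map' U.subtype U.ker_subtype, fun i => (s i).2⟩
        · intro s _ t _ hst
          ext i
          exact congrFun hst i
        · intro a ha
          simp only [Finset.mem_filter, Finset.mem_univ, true_and] at ha
          refine ⟨fun i => ⟨a i, ha.2 i⟩, ?_, rfl⟩
          simp only [Finset.mem_filter, Finset.mem_univ, true_and]
          exact LinearIndependent.of_comp U.subtype ha.1
    _ = _ := by
        rw [card_linearIndependent (hkd.trans hUd.ge), hUd, Finset.prod_range, Nat.cast_prod]
        refine Finset.prod_congr rfl fun i _ => ?_
        rw [Nat.cast_sub (Nat.pow_le_pow_right Fintype.card_pos (by omega)),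
          Nat.card_eq_fintype_card]
        push_cast
        rfl

end CharacterSums

/-! ### Separating the eigenvalues at rank at least two from `λ_0` and `λ_1` -/

section Eigenvalues

theorem prod_pow_sub_pow_succ (q : ℝ) (m d : ℕ) :
    ∏ i ∈ Finset.range (m + 1), (q ^ (d + 1) - q ^ i) =
      (q ^ (d + 1) - 1) * q ^ m * ∏ i ∈ Finset.range m, (q ^ d - q ^ i) := by
  rw [Finset.prod_range_succ', pow_zero, mul_comm, mul_assoc]
  congr 1
  have : ∀ i ∈ Finset.range m, q ^ (d + 1) - q ^ (i + 1) = q * (q ^ d - q ^ i) := by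
    intro i _; ring
  rw [Finset.prod_congr rfl this, Finset.prod_mul_distrib, Finset.prod_const, Finset.card_range]

theorem prod_pow_sub_pow_eq (q : ℝ) (e m : ℕ) :
    ∏ i ∈ Finset.range m, (q ^ (e + m) - q ^ i) =
      q ^ m.choose 2 * ∏ s ∈ Finset.Icc 1 m, (q ^ (e + s) - 1) := by
  induction m with
  | zero => simp
  | succ m ih =>
    rw [← add_assoc, prod_pow_sub_pow_succ, ih, Finset.prod_Icc_succ_top (by omega),
      Nat.choose_succ_succ' m 1, Nat.choose_one_right, pow_add]
    ring_nf

theorem prod_pow_sub_pow_pos {q : ℝ} (hq : 1 < q) {m d : ℕ} (h : m ≤ d) :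
    0 < ∏ i ∈ Finset.range m, (q ^ d - q ^ i) :=
  Finset.prod_pos fun _ hi => sub_pos.2
    (pow_lt_pow_right₀ hq ((Finset.mem_range.1 hi).trans_le h))

variable (F : Type*)

theorem eigval_zero_eq {n ℓ : ℕ} (h : n ≤ ℓ) :
    eigval F n ℓ 0 =
      ∏ i ∈ Finset.range n, ((Nat.card F : ℝ) ^ ℓ - (Nat.card F : ℝ) ^ i) := by
  have := prod_pow_sub_pow_eq (Nat.card F : ℝ) (ℓ - n) n
  rw [Nat.sub_add_cancel h] at this
  simp [eigval, this]

theorem eigval_one_eq {n ℓ : ℕ} (h : n ≤ ℓ) :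
    eigval F (n + 1) (ℓ + 1) 1 = -((Nat.card F : ℝ) ^ n *
      ∏ i ∈ Finset.range n, ((Nat.card F : ℝ) ^ ℓ - (Nat.card F : ℝ) ^ i)) := by
  have := prod_pow_sub_pow_eq (Nat.card F : ℝ) (ℓ - n) n
  rw [Nat.sub_add_cancel h] at this
  rw [this, eigval, Nat.choose_succ_succ' n 1, Nat.choose_one_right, pow_add]
  simp only [Nat.add_sub_cancel, Nat.add_sub_add_right]
  ring

/-- This ratio is what makes the shift by `x q^(-ℓ)` in (iv) come out right. -/
theorem eigval_zero_eq_mul_eigval_one {n ℓ : ℕ} (hn : 1 ≤ n) (h : n ≤ ℓ) :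
    eigval F n ℓ 0 = -(((Nat.card F : ℝ) ^ ℓ - 1) * eigval F n ℓ 1) := by
  obtain ⟨n, rfl⟩ := Nat.exists_eq_add_of_le' hn
  obtain ⟨ℓ, rfl⟩ := Nat.exists_eq_add_of_le' (hn.trans h)
  rw [eigval_zero_eq F h, eigval_one_eq F (by omega), prod_pow_sub_pow_succ]
  ring

variable {F} {V : Type*} [Field F] [AddCommGroup V] [Module F V] [Fintype V] {ψ : AddChar F ℂ}

theorem indepCharSum_comp_perm {m : ℕ} (c : Fin m → Module.Dual F V) (σ : Equiv.Perm (Fin m)) :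
    indepCharSum ψ (c ∘ σ) = indepCharSum ψ c := by
  classical
  unfold indepCharSum
  rw [← (Equiv.arrowCongr σ.symm (Equiv.refl V)).sum_comp]
  refine Finset.sum_congr rfl fun a _ => ?_
  have h1 : (Equiv.arrowCongr σ.symm (Equiv.refl V)) a = a ∘ σ := rfl
  rw [h1]
  have h2 : ∑ i, (c ∘ σ) i ((a ∘ σ) i) = ∑ i, c i (a i) := Equiv.sum_comp σ fun i => c i (a i)
  rw [h2]
  exact if_congr (linearIndependent_equiv σ) rfl rfl

theorem exists_perm_map_pair {k : ℕ} {i j : Fin (k + 2)} (h : i ≠ j) :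
    ∃ σ : Equiv.Perm (Fin (k + 2)), σ 0 = i ∧ σ 1 = j := by
  have hj : Equiv.swap 0 i j ≠ 0 := by
    intro h0
    have := congrArg (Equiv.swap 0 i) h0
    rw [Equiv.swap_apply_self, Equiv.swap_apply_left] at this
    exact h this.symm
  refine ⟨(Equiv.swap 1 (Equiv.swap 0 i j)).trans (Equiv.swap 0 i), ?_, ?_⟩
  · rw [Equiv.trans_apply, Equiv.swap_apply_of_ne_of_ne (by simp) hj.symm, Equiv.swap_apply_left]
  · rw [Equiv.trans_apply, Equiv.swap_apply_left, Equiv.swap_apply_self]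

variable [Fintype F]

/-- The twisted sum at a tuple of functionals of rank at least two is an eigenvalue different from
`λ₀` and `λ₁`. -/
theorem indepCharSum_ne_eigval (hψ : ψ ≠ 0) {n ℓ : ℕ} (hnℓ : n ≤ ℓ)
    (hV : Module.finrank F V = ℓ) (c : Fin n → Module.Dual F V) {i j : Fin n} (h₀ : c i ≠ 0)
    (h₁ : ¬ LinearMap.ker (c i) ≤ LinearMap.ker (c j)) :
    indepCharSum ψ c ≠ eigval F n ℓ 0 ∧ indepCharSum ψ c ≠ eigval F n ℓ 1 := by
  have hij : i ≠ j := by rintro rfl; exact h₁ le_rfl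
  obtain ⟨k, rfl⟩ : ∃ k, n = k + 2 := ⟨n - 2, by omega⟩
  obtain ⟨d, rfl⟩ : ∃ d, ℓ = d + 2 := ⟨ℓ - 2, by omega⟩
  have hkd : k ≤ d := by omega
  obtain ⟨σ, rfl, rfl⟩ := exists_perm_map_pair hij
  have hc : c ∘ σ = Fin.cons (c (σ 0)) (Fin.cons (c (σ 1)) (fun t : Fin k => c (σ t.succ.succ)) :
      Fin (k + 1) → Module.Dual F V) := by
    funext t
    refine Fin.cases rfl (fun t => ?_) t
    exact Fin.cases rfl (fun t => rfl) t
  have hle := norm_indepCharSum_cons_cons_le hψ hkd hV (fun t : Fin k => c (σ t.succ.succ))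
    _ _ h₁ h₀
  have heq := indepCharSum_cons_cons hψ (fun t : Fin k => c (σ t.succ.succ)) _ _ h₁ h₀
  rw [← hc, indepCharSum_comp_perm] at hle heq
  have hq : (2 : ℝ) ≤ Nat.card F := by exact_mod_cast Finite.one_lt_card (α := F)
  have hP := prod_pow_sub_pow_pos (by linarith : (1 : ℝ) < Nat.card F) hkd
  have he1 : eigval F (k + 2) (d + 2) 1 = -(((Nat.card F : ℝ) ^ (d + 1) - 1) *
      ((Nat.card F : ℝ) ^ (2 * k + 1) *
        ∏ i ∈ Finset.range k, ((Nat.card F : ℝ) ^ d - (Nat.card F : ℝ) ^ i))) := by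
    rw [eigval_one_eq F (by omega), prod_pow_sub_pow_succ]
    ring
  have he0 := eigval_zero_eq_mul_eigval_one F (by omega) hnℓ
  set B := (Nat.card F : ℝ) ^ (2 * k + 1) *
        ∏ i ∈ Finset.range k, ((Nat.card F : ℝ) ^ d - (Nat.card F : ℝ) ^ i) with hB
  have hBpos : 0 < B := by positivity
  have hq1 : (2 : ℝ) ≤ (Nat.card F : ℝ) ^ (d + 1) :=
    hq.trans (le_self_pow₀ (by linarith) (by omega))
  have hq2 : ∀ e : ℕ, (4 : ℝ) ≤ (Nat.card F : ℝ) ^ (e + 2) := fun e => by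
    calc (4 : ℝ) = 2 ^ 2 := by norm_num
      _ ≤ (Nat.card F : ℝ) ^ 2 := by gcongr
      _ ≤ _ := pow_le_pow_right₀ (by linarith) (by omega)
  constructor
  · intro h
    -- Here `|λ_0| = (q^(d+2) - 1)(q^(d+1) - 1) B ≥ 3B`, against the upper bound `B`.
    rw [h, Complex.norm_real, Real.norm_eq_abs, he0, he1] at hle
    have := (le_abs_self _).trans hle
    have h3 : B ≤ ((Nat.card F : ℝ) ^ (d + 1) - 1) * B := le_mul_of_one_le_left hBpos.le
      (by linarith)
    nlinarith [hq2 d]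
  · intro h
    -- For `d = 0` and `q = 2` one has `|λ_1| = B`, so the norm cannot decide. There the sum is
    -- computed exactly: it equals `q > 0`, while `λ_1 < 0`.
    rcases Nat.eq_zero_or_pos d with rfl | hd
    · obtain rfl : k = 0 := by omega
      have hval : indepCharSum ψ c = ((Nat.card F : ℝ) : ℂ) := by
        rw [heq]
        simp
      rw [hval, Complex.ofReal_inj, he1] at h
      have : 0 < ((Nat.card F : ℝ) ^ (0 + 1) - 1) * B := mul_pos (by linarith) hBpos
      linarith
    · obtain ⟨e, rfl⟩ := Nat.exists_eq_add_of_le' hd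
      rw [h, Complex.norm_real, Real.norm_eq_abs, he1, abs_neg] at hle
      have := (le_abs_self _).trans hle
      nlinarith [hq2 e]

end Eigenvalues

/-! ### Fourier analysis on the group of `n × ℓ` matrices -/

section Fourier

variable {F : Type*} [Field F] {n ℓ : ℕ}

/-- The `i`-th row of `C`, as the linear functional `v ↦ ∑ j, v j * C i j`. -/
def rowDual (C : Fin n → Fin ℓ → F) (i : Fin n) : Module.Dual F (Fin ℓ → F) :=
  Fintype.linearCombination F (C i)

theorem rowDual_apply (C : Fin n → Fin ℓ → F) (i : Fin n) (v : Fin ℓ → F) :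
    rowDual C i v = ∑ j, v j * C i j := by
  simp [rowDual, Fintype.linearCombination_apply]

/-- The trace form on `n × ℓ` matrices. -/
def tracePair (C A : Fin n → Fin ℓ → F) : F := ∑ i, rowDual C i (A i)

theorem tracePair_eq (C A : Fin n → Fin ℓ → F) : tracePair C A = ∑ i, ∑ j, A i j * C i j := by
  simp [tracePair, rowDual_apply]

theorem tracePair_add (C A B : Fin n → Fin ℓ → F) :
    tracePair C (A + B) = tracePair C A + tracePair C B := by
  simp [tracePair_eq, add_mul, Finset.sum_add_distrib]

theorem tracePair_neg_left (C A : Fin n → Fin ℓ → F) :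
    tracePair (-C) A = -tracePair C A := by
  simp [tracePair_eq]

theorem tracePair_neg_right (C A : Fin n → Fin ℓ → F) :
    tracePair C (-A) = -tracePair C A := by
  simp [tracePair_eq]

theorem linearIndependent_neg_iff {ι V : Type*} [AddCommGroup V] [Module F V] {v : ι → V} :
    LinearIndependent F (-v) ↔ LinearIndependent F v := by
  have h := (LinearMap.linearIndependent_iff (LinearEquiv.neg F : V ≃ₗ[F] V).toLinearMap
    (LinearEquiv.ker _) (v := v))
  exact h

variable [Fintype F]

/-- The Fourier transform of a function of `n × ℓ` matrices. -/
def matHat (ψ : AddChar F ℂ) (f : (Fin n → Fin ℓ → F) → ℝ) (C : Fin n → Fin ℓ → F) : ℂ :=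
  ∑ A, (f A : ℂ) * ψ (tracePair C A)

variable {ψ : AddChar F ℂ}

theorem sum_char_tracePair (hψ : ψ ≠ 0) (A : Fin n → Fin ℓ → F) [Decidable (A = 0)] :
    ∑ C : Fin n → Fin ℓ → F, ψ (tracePair C A) =
      if A = 0 then (Fintype.card (Fin n → Fin ℓ → F) : ℂ) else 0 := by
  split_ifs with h
  · subst h
    simp [tracePair_eq]
  · have h1 : ∃ i j, A i j ≠ 0 := by
      by_contra! h1
      exact h (funext fun i => funext fun j => h1 i j)
    obtain ⟨i, j, hij⟩ := h1
    let c : Module.Dual F (Fin n → Fin ℓ → F) :=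
      { toFun := fun C => tracePair C A
        map_add' := fun C D => by simp [tracePair_eq, mul_add, Finset.sum_add_distrib]
        map_smul' := fun r C => by simp [tracePair_eq, Finset.mul_sum, mul_left_comm] }
    refine sum_char_dual_eq_zero (c := c) hψ fun hc => hij ?_
    have := DFunLike.congr_fun hc (Pi.single i (Pi.single j 1))
    simpa [c, tracePair_eq, Pi.single_apply, apply_ite, ite_apply] using this

/-- Parseval's identity. Since `g` is real, evaluating at `-C` plays the role of complex
conjugation. -/
theorem sum_matHat_mul_matHat_neg (hψ : ψ ≠ 0) (f g : (Fin n → Fin ℓ → F) → ℝ) :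
    ∑ C, matHat ψ f C * matHat ψ g (-C) =
      (Fintype.card (Fin n → Fin ℓ → F) : ℂ) * ((∑ A, f A * g A : ℝ) : ℂ) := by
  classical
  have h1 : ∀ C, matHat ψ f C * matHat ψ g (-C) =
      ∑ A, ∑ B, (f A * g B : ℂ) * ψ (tracePair C (A - B)) := by
    intro C
    rw [matHat, matHat, Finset.sum_mul_sum]
    refine Finset.sum_congr rfl fun A _ => Finset.sum_congr rfl fun B _ => ?_
    rw [sub_eq_add_neg, tracePair_add, tracePair_neg_right, tracePair_neg_left,
      AddChar.map_add_eq_mul]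
    ring
  simp only [h1]
  rw [Finset.sum_comm]
  push_cast
  rw [Finset.mul_sum]
  refine Finset.sum_congr rfl fun A _ => ?_
  rw [Finset.sum_comm]
  simp only [← Finset.mul_sum, sum_char_tracePair hψ, sub_eq_zero, mul_ite, mul_zero,
    Finset.sum_ite_eq, Finset.mem_univ, if_true]
  ring

open Classical in
/-- Convolution with the set of matrices of rank `n`. -/
def rankConv (f : (Fin n → Fin ℓ → F) → ℝ) (A : Fin n → Fin ℓ → F) : ℝ :=
  ∑ B, if LinearIndependent F (B - A) then f B else 0

theorem rankConv_eq_sum_add (f : (Fin n → Fin ℓ → F) → ℝ) (A : Fin n → Fin ℓ → F)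
    [DecidablePred fun D : Fin n → Fin ℓ → F => LinearIndependent F D] :
    rankConv f A = ∑ D, if LinearIndependent F D then f (A + D) else 0 := by
  unfold rankConv
  rw [← Equiv.sum_comp (Equiv.addLeft A)]
  refine Finset.sum_congr rfl fun D _ => ?_
  simp only [Equiv.coe_addLeft, add_sub_cancel_left]

/-- The convolution theorem; it uses that the rank-`n` matrices are closed under negation. -/
theorem matHat_rankConv (f : (Fin n → Fin ℓ → F) → ℝ) (C : Fin n → Fin ℓ → F) :
    matHat ψ (rankConv f) C = matHat ψ f C * indepCharSum ψ (rowDual C) := by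
  classical
  have h1 : ∀ A, (rankConv f A : ℂ) * ψ (tracePair C A) = ∑ B,
      if LinearIndependent F (A - B) then (f B : ℂ) * ψ (tracePair C A) else 0 := by
    intro A
    rw [rankConv]
    push_cast
    rw [Finset.sum_mul]
    refine Finset.sum_congr rfl fun B _ => ?_
    rw [← linearIndependent_neg_iff, neg_sub]
    split_ifs <;> simp
  unfold matHat
  simp only [h1]
  rw [Finset.sum_comm, Finset.sum_mul]
  refine Finset.sum_congr rfl fun B _ => ?_
  rw [indepCharSum, Finset.mul_sum, ← Equiv.sum_comp (Equiv.addRight B)]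
  refine Finset.sum_congr rfl fun D _ => ?_
  simp only [Equiv.coe_addRight, add_sub_cancel_right, tracePair_add, AddChar.map_add_eq_mul]
  split_ifs
  · rw [tracePair]; ring
  · simp

/-- If all the sums of `g` over the matrices with a prescribed value at a nonzero vector vanish,
then so does its transform at the matrices of rank at most one. -/
theorem matHat_eq_zero_of_sum_eq_zero {g : (Fin n → Fin ℓ → F) → ℝ} (hn : 1 ≤ n)
    [DecidableEq F]
    (hg : ∀ (u : Fin n → F) (w : Fin ℓ → F), u ≠ 0 →
      ∑ A : Fin n → Fin ℓ → F, (if ∑ i, u i • A i = w then g A else 0) = 0)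
    {C : Fin n → Fin ℓ → F} (hC : ∀ i j, rowDual C i ≠ 0 →
      LinearMap.ker (rowDual C i) ≤ LinearMap.ker (rowDual C j)) :
    matHat ψ g C = 0 := by
  -- Rank at most one means that all rows of `C` are multiples `u i • c` of one functional, so the
  -- trace form sees `A` only through `uA`. For `C = 0` any nonzero `u` will do with `c = 0`.
  obtain ⟨u, hu, c, huc⟩ : ∃ u : Fin n → F, u ≠ 0 ∧ ∃ c : Module.Dual F (Fin ℓ → F),
      ∀ A, tracePair C A = c (∑ i, u i • A i) := by
    by_cases h : ∀ i, rowDual C i = 0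
    · refine ⟨fun _ => 1, fun h1 => one_ne_zero (congrFun h1 ⟨0, hn⟩), 0, fun A => ?_⟩
      simp [tracePair, h]
    · push Not at h
      obtain ⟨i₀, hi₀⟩ := h
      have hs : ∀ j, ∃ t : F, rowDual C j = t • rowDual C i₀ := fun j => by
        have := mem_span_of_iInf_ker_le_ker (L := fun _ : Unit => rowDual C i₀)
          (K := rowDual C j) (by simpa using hC i₀ j hi₀)
        rw [Set.range_const, Submodule.mem_span_singleton] at this
        obtain ⟨t, ht⟩ := this
        exact ⟨t, ht.symm⟩
      choose u hu using hs
      refine ⟨u, ?_, rowDual C i₀, fun A => ?_⟩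
      · rintro rfl
        apply hi₀
        rw [hu i₀]; simp
      · rw [tracePair, map_sum]
        refine Finset.sum_congr rfl fun i _ => ?_
        rw [hu i]; simp
  -- Group the matrices by the value `w = uA`, on which the character is constant.
  have h1 : matHat ψ g C = ∑ w : Fin ℓ → F,
      ((∑ A : Fin n → Fin ℓ → F, (if ∑ i, u i • A i = w then g A else 0) : ℝ) : ℂ) * ψ (c w) := by
    push_cast
    simp only [Finset.sum_mul]
    rw [Finset.sum_comm, matHat]
    refine Finset.sum_congr rfl fun A _ => ?_
    rw [huc, Finset.sum_eq_single (∑ i, u i • A i)]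
    · simp
    · intro w _ hw
      simp [hw.symm]
    · simp
  rw [h1]
  refine Finset.sum_eq_zero fun w _ => ?_
  rw [hg u w hu]
  simp

/-- In Parseval's sum every term has a zero factor: the transform of `g` at rank at most one, the
transform of `v` at higher rank, where the eigenvalue is not `r`. -/
theorem sum_mul_eq_zero_of_rankConv_eq {v g : (Fin n → Fin ℓ → F) → ℝ} (hn : 1 ≤ n) (hnℓ : n ≤ ℓ)
    [DecidableEq F]
    (hg : ∀ (u : Fin n → F) (w : Fin ℓ → F), u ≠ 0 →
      ∑ A : Fin n → Fin ℓ → F, (if ∑ i, u i • A i = w then g A else 0) = 0)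
    {r : ℝ} (hr : r = eigval F n ℓ 0 ∨ r = eigval F n ℓ 1) (hv : rankConv v = r • v) :
    ∑ A, g A * v A = 0 := by
  obtain ⟨ψ, hψ⟩ : ∃ ψ : AddChar F ℂ, ψ ≠ 0 := by
    obtain ⟨ψ, hψ⟩ := AddChar.exists_apply_ne_zero (a := (1 : F)).2 one_ne_zero
    exact ⟨ψ, by rintro rfl; simp at hψ⟩
  have h := sum_matHat_mul_matHat_neg hψ v g
  have h0 : ∑ C, matHat ψ v C * matHat ψ g (-C) = 0 := by
    refine Finset.sum_eq_zero fun C _ => ?_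
    by_cases hC : ∀ i j, rowDual C i ≠ 0 →
      LinearMap.ker (rowDual C i) ≤ LinearMap.ker (rowDual C j)
    · have hneg : ∀ i, rowDual (-C) i = -rowDual C i := fun i => by
        ext; simp [rowDual]
      rw [matHat_eq_zero_of_sum_eq_zero hn hg, mul_zero]
      intro i j hi
      rw [hneg] at hi
      simp only [hneg]
      intro x hx
      have := hC i j (neg_ne_zero.1 hi) (show rowDual C i x = 0 by simpa using hx)
      have h' : rowDual C j x = 0 := this
      simp [h']
    · push Not at hC
      obtain ⟨i, j, hi, hij⟩ := hC
      have hne := indepCharSum_ne_eigval hψ hnℓ (by simp) (rowDual C) hi hij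
      have h2 := matHat_rankConv (ψ := ψ) v C
      have h3 : matHat ψ (r • v) C = r * matHat ψ v C := by
        simp [matHat, Finset.mul_sum, mul_assoc]
      rw [hv, h3] at h2
      have h4 : matHat ψ v C * (indepCharSum ψ (rowDual C) - r) = 0 := by
        rw [mul_sub, ← h2]; ring
      rcases mul_eq_zero.1 h4 with h5 | h5
      · rw [h5, zero_mul]
      · exfalso
        rw [sub_eq_zero] at h5
        rcases hr with rfl | rfl
        · exact hne.1 h5
        · exact hne.2 h5
  rw [h0] at h
  have h6 := (mul_eq_zero.1 h.symm).resolve_left (Nat.cast_ne_zero.2 Fintype.card_ne_zero)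
  rw [Complex.ofReal_eq_zero] at h6
  rw [← h6]
  exact Finset.sum_congr rfl fun A _ => mul_comm _ _

end Fourier

/-! ### Members of `𝓜_n` as graphs of matrices -/

section Graphs

variable {F : Type*} [Field F] {n ℓ : ℕ}

variable (F n ℓ) in
/-- The projection of the column space to the first `n` coordinates. -/
def projHead : Space F n ℓ →ₗ[F] (Fin n → F) := LinearMap.funLeft F F (Fin.castAdd ℓ)

variable (F n ℓ) in
/-- The projection of the column space to the last `ℓ` coordinates. -/
def projTail : Space F n ℓ →ₗ[F] (Fin ℓ → F) := LinearMap.funLeft F F (Fin.natAdd n)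

theorem projHead_append (u : Fin n → F) (w : Fin ℓ → F) :
    projHead F n ℓ (Fin.append u w) = u := by
  ext i; simp [projHead, LinearMap.funLeft_apply]

theorem projTail_append (u : Fin n → F) (w : Fin ℓ → F) :
    projTail F n ℓ (Fin.append u w) = w := by
  ext i; simp [projTail, LinearMap.funLeft_apply]

theorem eq_of_proj_eq {x y : Space F n ℓ} (h : projHead F n ℓ x = projHead F n ℓ y)
    (h' : projTail F n ℓ x = projTail F n ℓ y) : x = y := by
  funext i
  refine Fin.addCases (fun i => ?_) (fun i => ?_) i
  · exact congrFun h i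
  · exact congrFun h' i

theorem E_eq_ker : E F n ℓ = LinearMap.ker (projHead F n ℓ) := by
  refine le_antisymm ?_ fun x hx => ?_
  · rw [E, Submodule.span_le]
    rintro _ ⟨i, rfl⟩
    ext j
    have hne : Fin.castAdd ℓ j ≠ Fin.natAdd n i := fun h => by
      have := congrArg Fin.val h
      simp at this
      omega
    simp [projHead, LinearMap.funLeft_apply, hne]
  · have hx' : x = ∑ i : Fin ℓ, x (Fin.natAdd n i) • Pi.single (Fin.natAdd n i) (1 : F) := by
      funext k
      rw [Finset.sum_apply]
      refine Fin.addCases (fun k => ?_) (fun k => ?_) k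
      · have h0 : x (Fin.castAdd ℓ k) = 0 := congrFun hx k
        rw [h0, Finset.sum_eq_zero]
        intro i _
        have hne : Fin.castAdd ℓ k ≠ Fin.natAdd n i := fun h => by
          have := congrArg Fin.val h
          simp at this
          omega
        simp [hne]
      · simp [Pi.single_apply]
    rw [hx']
    exact Submodule.sum_mem _ fun i _ =>
      Submodule.smul_mem _ _ (Submodule.subset_span ⟨i, rfl⟩)

theorem finrank_E : Module.finrank F (E F n ℓ) = ℓ := by
  have h := LinearMap.finrank_range_add_finrank_ker (projHead F n ℓ)
  have hs : LinearMap.range (projHead F n ℓ) = ⊤ :=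
    LinearMap.range_eq_top.2 fun u => ⟨Fin.append u 0, projHead_append u 0⟩
  rw [hs, ← E_eq_ker, finrank_top] at h
  simpa using h

/-- The subspace of the vectors `(u, u A)`, where `A` has the rows `A i`. -/
def rowGraph (A : Fin n → Fin ℓ → F) : Submodule F (Space F n ℓ) :=
  LinearMap.eqLocus (projTail F n ℓ) (Fintype.linearCombination F A ∘ₗ projHead F n ℓ)

theorem mem_rowGraph {A : Fin n → Fin ℓ → F} {x : Space F n ℓ} :
    x ∈ rowGraph A ↔ projTail F n ℓ x = Fintype.linearCombination F A (projHead F n ℓ x) :=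
  Iff.rfl

theorem append_mem_rowGraph {A : Fin n → Fin ℓ → F} {u : Fin n → F} {w : Fin ℓ → F} :
    Fin.append u w ∈ rowGraph A ↔ Fintype.linearCombination F A u = w := by
  rw [mem_rowGraph, projHead_append, projTail_append, eq_comm]

theorem eq_zero_of_mem_rowGraph {A : Fin n → Fin ℓ → F} {x : Space F n ℓ} (hx : x ∈ rowGraph A)
    (h0 : projHead F n ℓ x = 0) : x = 0 := by
  refine eq_of_proj_eq (by simpa using h0) ?_
  rw [mem_rowGraph.1 hx, h0]; simp

theorem disjoint_rowGraph_E (A : Fin n → Fin ℓ → F) : Disjoint (rowGraph A) (E F n ℓ) := by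
  rw [Submodule.disjoint_def]
  intro x hx hE
  rw [E_eq_ker] at hE
  exact eq_zero_of_mem_rowGraph hx hE

theorem finrank_rowGraph (A : Fin n → Fin ℓ → F) : Module.finrank F (rowGraph A) = n := by
  have e : rowGraph A ≃ₗ[F] (Fin n → F) := LinearEquiv.ofBijective
    ((projHead F n ℓ).domRestrict (rowGraph A)) ⟨?_, fun u => ?_⟩
  · simpa using e.finrank_eq
  · rw [← LinearMap.ker_eq_bot, LinearMap.ker_eq_bot']
    intro x hx
    exact Subtype.ext (eq_zero_of_mem_rowGraph x.2 hx)
  · exact ⟨⟨Fin.append u _, append_mem_rowGraph.2 rfl⟩, projHead_append u _⟩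

theorem mem_attenuated_iff {m : ℕ} {P : Submodule F (Space F n ℓ)} :
    P ∈ attenuated F n ℓ m ↔ Module.finrank F P = m ∧ Disjoint P (E F n ℓ) := by
  rw [disjoint_iff, ← Submodule.finrank_eq_zero (R := F)]
  rfl

theorem rowGraph_mem_attenuated (A : Fin n → Fin ℓ → F) : rowGraph A ∈ attenuated F n ℓ n :=
  mem_attenuated_iff.2 ⟨finrank_rowGraph A, disjoint_rowGraph_E A⟩

theorem rowGraph_injective :
    Function.Injective (rowGraph : (Fin n → Fin ℓ → F) → Submodule F (Space F n ℓ)) := by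
  intro A B h
  funext i
  have h1 : Fin.append (Pi.single i 1) (A i) ∈ rowGraph A := by
    rw [append_mem_rowGraph]; simp
  rw [h, append_mem_rowGraph] at h1
  simpa using h1.symm

/-- Since `E` is the kernel of `projHead`, this projection is injective on `P`, hence bijective by
dimension; composing its inverse with `projTail` gives the matrix. -/
theorem exists_rowGraph_eq {P : Submodule F (Space F n ℓ)} (hP : P ∈ attenuated F n ℓ n) :
    ∃ A : Fin n → Fin ℓ → F, rowGraph A = P := by
  obtain ⟨hn, hE⟩ := mem_attenuated_iff.1 hP
  rw [E_eq_ker, Submodule.disjoint_def] at hE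
  have hinj : Function.Injective ((projHead F n ℓ).domRestrict P) := by
    rw [← LinearMap.ker_eq_bot, LinearMap.ker_eq_bot']
    exact fun x hx => Subtype.ext (hE x x.2 hx)
  let e : P ≃ₗ[F] (Fin n → F) := LinearEquiv.ofInjectiveOfFinrankEq
    ((projHead F n ℓ).domRestrict P) hinj (by simp [hn])
  have he : ∀ x : P, e x = projHead F n ℓ x := fun x => rfl
  let g : (Fin n → F) →ₗ[F] (Fin ℓ → F) := projTail F n ℓ ∘ₗ P.subtype ∘ₗ e.symm.toLinearMap
  have hg : Fintype.linearCombination F (fun i => g (Pi.single i 1)) = g := by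
    refine (Pi.basisFun F (Fin n)).ext fun i => ?_
    simp
  refine ⟨fun i => g (Pi.single i 1), ?_⟩
  have hle : P ≤ rowGraph fun i => g (Pi.single i 1) := by
    intro x hx
    rw [mem_rowGraph, hg, ← he ⟨x, hx⟩]
    simp [g]
  exact (Submodule.eq_of_le_of_finrank_eq hle (by rw [finrank_rowGraph, hn])).symm

variable (F n ℓ) in
/-- The matrices parametrize `𝓜_n`. -/
def graphEquiv : (Fin n → Fin ℓ → F) ≃ attenuated F n ℓ n :=
  Equiv.ofBijective (fun A => ⟨rowGraph A, rowGraph_mem_attenuated A⟩)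
    ⟨fun _ _ h => rowGraph_injective (congrArg Subtype.val h), fun P => by
      obtain ⟨A, hA⟩ := exists_rowGraph_eq P.2
      exact ⟨A, Subtype.ext hA⟩⟩

theorem coe_graphEquiv (A : Fin n → Fin ℓ → F) :
    (graphEquiv F n ℓ A : Submodule F (Space F n ℓ)) = rowGraph A := rfl

theorem linearCombination_sub (A B : Fin n → Fin ℓ → F) (u : Fin n → F) :
    Fintype.linearCombination F (B - A) u =
      Fintype.linearCombination F B u - Fintype.linearCombination F A u := by
  simp [Fintype.linearCombination_apply, smul_sub]

/-- The common vectors are the `(u, uA)` with `u (B - A) = 0`. -/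
theorem disjoint_rowGraph_iff (A B : Fin n → Fin ℓ → F) :
    Disjoint (rowGraph A) (rowGraph B) ↔ LinearIndependent F (B - A) := by
  rw [linearIndependent_iff_injective_fintypeLinearCombination, ← LinearMap.ker_eq_bot,
    LinearMap.ker_eq_bot',
    Submodule.disjoint_def]
  constructor
  · intro h u hu
    rw [linearCombination_sub, sub_eq_zero] at hu
    have := h (Fin.append u (Fintype.linearCombination F A u)) (append_mem_rowGraph.2 rfl)
      (append_mem_rowGraph.2 hu)
    rw [← projHead_append u (Fintype.linearCombination F A u), this, map_zero]
  · intro h x hA hB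
    refine eq_zero_of_mem_rowGraph hA (h _ ?_)
    rw [linearCombination_sub, ← mem_rowGraph.1 hA, ← mem_rowGraph.1 hB, sub_self]

theorem span_append_mem_attenuated {u : Fin n → F} (hu : u ≠ 0) (w : Fin ℓ → F) :
    Submodule.span F {Fin.append u w} ∈ attenuated F n ℓ 1 := by
  have hne : Fin.append u w ≠ 0 := fun h => hu (by rw [← projHead_append u w, h, map_zero])
  refine mem_attenuated_iff.2 ⟨finrank_span_singleton hne, ?_⟩
  rw [disjoint_comm, Submodule.disjoint_span_singleton' hne, E_eq_ker, LinearMap.mem_ker,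
    projHead_append]
  exact hu

theorem mem_attenuated_one_iff {τ : Submodule F (Space F n ℓ)} :
    τ ∈ attenuated F n ℓ 1 ↔ Module.finrank F τ = 1 ∧ ¬ τ ≤ E F n ℓ := by
  rw [mem_attenuated_iff]
  refine and_congr_right fun h => ?_
  obtain ⟨x, hx0, rfl⟩ : ∃ x, x ≠ 0 ∧ τ = Submodule.span F {x} := by
    obtain ⟨x, hx, h1⟩ := finrank_eq_one_iff'.1 h
    refine ⟨x, fun h => hx (Subtype.ext h), le_antisymm (fun y hy => ?_) ?_⟩
    · obtain ⟨c, hc⟩ := h1 ⟨y, hy⟩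
      exact Submodule.mem_span_singleton.2 ⟨c, congrArg Subtype.val hc⟩
    · exact (Submodule.span_singleton_le_iff_mem _ _).2 x.2
  rw [disjoint_comm, Submodule.disjoint_span_singleton' hx0, Submodule.span_singleton_le_iff_mem]

end Graphs

/-! ### Attenuated spreads and their construction -/

section Spreads

variable {F : Type*} [Field F] {n ℓ : ℕ}

theorem IsAttenuatedSpread.subset_attenuated {S : Set (Submodule F (Space F n ℓ))} (hnℓ : n ≤ ℓ)
    (hS : IsAttenuatedSpread S) : S ⊆ attenuated F n ℓ n := by
  obtain ⟨P, hE, ⟨hP, hT⟩, rfl⟩ := hS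
  rintro W ⟨hW, hWE⟩
  have hdisj : Disjoint W (E F n ℓ) := by
    rw [Submodule.disjoint_def]
    intro x hx hxE
    by_contra hx0
    obtain ⟨U, -, hU⟩ := hP (Submodule.span F {x}) (finrank_span_singleton hx0)
    simp only [Submodule.span_singleton_le_iff_mem] at hU
    exact hWE ((hU W ⟨hW, hx⟩).trans (hU _ ⟨hE, hxE⟩).symm)
  refine mem_attenuated_iff.2 ⟨?_, hdisj⟩
  have hdim : Module.finrank F W ∈ ({ℓ, n} : Set ℕ) := hT ▸ Set.mem_image_of_mem _ hW
  -- A member of dimension `ℓ` that is disjoint from `E` needs `2ℓ ≤ n + ℓ`, which forces `ℓ = n`.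
  rcases hdim with h | h
  · have h1 := Submodule.finrank_add_finrank_le_of_disjoint hdisj
    rw [finrank_E] at h1
    simp only [Module.finrank_fintype_fun_eq_card, Fintype.card_fin] at h1
    have h2 : Module.finrank F W = ℓ := h
    omega
  · exact h

theorem IsAttenuatedSpread.existsUnique {S : Set (Submodule F (Space F n ℓ))}
    (hS : IsAttenuatedSpread S) {τ : Submodule F (Space F n ℓ)} (hτ : τ ∈ attenuated F n ℓ 1) :
    ∃! W, W ∈ S ∧ τ ≤ W := by
  obtain ⟨P, hE, ⟨hP, hT⟩, rfl⟩ := hS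
  obtain ⟨h1, h2⟩ := mem_attenuated_one_iff.1 hτ
  obtain ⟨W, ⟨hW, hτW⟩, hu⟩ := hP τ h1
  exact ⟨W, ⟨⟨hW, by rintro rfl; exact h2 hτW⟩, hτW⟩, fun U hU => hu U ⟨hU.1.1, hU.2⟩⟩

/-- A point lying in a member of `S \ S'` lies in a unique member of `S'`. That member cannot belong
to `S`, since by uniqueness in `S` it would be the original one. -/
theorem areConjugateSwitchingSets_sdiff {S S' : Set (Submodule F (Space F n ℓ))}
    (hS : IsAttenuatedSpread S) (hS' : IsAttenuatedSpread S') :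
    AreConjugateSwitchingSets (S \ S') (S' \ S) := by
  have key : ∀ {S S' : Set (Submodule F (Space F n ℓ))}, IsAttenuatedSpread S →
      IsAttenuatedSpread S' → coveredPoints (S \ S') ⊆ coveredPoints (S' \ S) := by
    rintro S S' hS hS' τ ⟨hτ, ρ, ⟨hρ, hρ'⟩, hτρ⟩
    obtain ⟨W, ⟨hW, hτW⟩, -⟩ := hS'.existsUnique hτ
    refine ⟨hτ, W, ⟨hW, fun hWS => hρ' ?_⟩, hτW⟩
    rw [(hS.existsUnique hτ).unique ⟨hρ, hτρ⟩ ⟨hWS, hτW⟩]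
    exact hW
  exact ⟨⟨S, hS, Set.sdiff_subset⟩, ⟨S', hS', Set.sdiff_subset⟩,
    Set.disjoint_left.2 fun _ h h' => h.2 h'.1, (key hS hS').antisymm (key hS' hS)⟩

/-- For `u ≠ 0`, the vector `(u, w)` lies on the graph of `t a` exactly when `u (t a) = w`, and
bijectivity gives exactly one such `a`. The vectors with `u = 0` form `E`. -/
theorem isAttenuatedSpread_range_rowGraph {ι : Type*} (hn : 1 ≤ n) (hnℓ : n ≤ ℓ)
    {t : ι → Fin n → Fin ℓ → F}
    (ht : ∀ u : Fin n → F, u ≠ 0 →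
      Function.Bijective fun a => Fintype.linearCombination F (t a) u) :
    IsAttenuatedSpread (Set.range fun a => rowGraph (t a)) := by
  have hEne : E F n ℓ ≠ ⊥ := fun h => by
    have := finrank_E (F := F) (n := n) (ℓ := ℓ)
    rw [h, finrank_bot] at this
    omega
  refine ⟨insert (E F n ℓ) (Set.range fun a => rowGraph (t a)), Set.mem_insert _ _, ⟨?_, ?_⟩, ?_⟩
  · intro τ hτ
    by_cases hτE : τ ≤ E F n ℓ
    · refine ⟨E F n ℓ, ⟨Set.mem_insert _ _, hτE⟩, ?_⟩
      rintro W ⟨rfl | ⟨a, rfl⟩, hW⟩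
      · rfl
      · have : τ = ⊥ := le_bot_iff.1 ((disjoint_rowGraph_E (t a)) hW hτE)
        rw [this, finrank_bot] at hτ
        omega
    · obtain ⟨x, hx, h1⟩ := finrank_eq_one_iff'.1 hτ
      have hτx : ∀ U, τ ≤ U ↔ (x : Space F n ℓ) ∈ U := fun U => by
        refine ⟨fun h => h x.2, fun h y hy => ?_⟩
        obtain ⟨c, hc⟩ := h1 ⟨y, hy⟩
        have : c • (x : Space F n ℓ) = y := congrArg Subtype.val hc
        exact this ▸ U.smul_mem c h
      have hu : projHead F n ℓ x ≠ 0 := fun h => hτE ((hτx _).2 (by rw [E_eq_ker]; exact h))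
      obtain ⟨a, ha⟩ := (ht _ hu).2 (projTail F n ℓ x)
      refine ⟨rowGraph (t a), ⟨Set.mem_insert_of_mem _ ⟨a, rfl⟩, (hτx _).2 ha.symm⟩, ?_⟩
      rintro W ⟨rfl | ⟨b, rfl⟩, hW⟩
      · exact absurd hW hτE
      · have hb := mem_rowGraph.1 ((hτx _).1 hW)
        rw [(ht _ hu).1 (ha.trans hb)]
  · have : Nonempty ι := by
      have hu : (fun _ => 1 : Fin n → F) ≠ 0 := fun h => one_ne_zero (congrFun h ⟨0, hn⟩)
      exact ⟨((ht _ hu).2 0).choose⟩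
    rw [Set.image_insert_eq, finrank_E, ← Set.range_comp]
    congr 1
    simp [Function.comp_def, finrank_rowGraph]
  · symm
    rw [Set.insert_sdiff_of_mem _ (Set.mem_singleton _)]
    refine Set.sdiff_singleton_eq_self ?_
    rintro ⟨a, ha⟩
    have := disjoint_rowGraph_E (t a)
    simp only [ha, disjoint_self] at this
    exact hEne this

variable [Finite F]

/-- A field multiplication on the row space `F ^ ℓ`. -/
theorem exists_field_mul (hℓ : 1 ≤ ℓ) : ∃ μ : (Fin ℓ → F) → (Fin ℓ → F) →ₗ[F] (Fin ℓ → F),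
    μ 0 = 0 ∧ (∀ v, v ≠ 0 → Function.Bijective fun a => μ a v) ∧
      ∀ a, a ≠ 0 → Function.Bijective (μ a) := by
  have : NeZero ℓ := ⟨by omega⟩
  obtain ⟨p, hp⟩ := CharP.exists F
  have : Fact p.Prime := ⟨(CharP.char_is_prime_or_zero F p).resolve_right fun h => by
    subst h
    have := CharP.charP_to_charZero F
    exact not_finite F⟩
  let K := FiniteField.Extension F p ℓ
  let φ : K ≃ₗ[F] (Fin ℓ → F) :=
    LinearEquiv.ofFinrankEq _ _ (by simp [K, FiniteField.finrank_extension])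
  refine ⟨fun a => φ.toLinearMap ∘ₗ LinearMap.mulLeft F (φ.symm a) ∘ₗ φ.symm.toLinearMap,
    by ext; simp, fun v hv => ?_, fun a ha => ?_⟩
  · exact φ.bijective.comp ((mulRight_bijective₀ _ (by simpa using hv)).comp φ.symm.bijective)
  · exact φ.bijective.comp ((mulLeft_bijective₀ _ (by simpa using ha)).comp φ.symm.bijective)

end Spreads

/-! ### Regular families of matrices and averaging over `GL(ℓ, q)` -/

section Averaging

theorem exists_linearEquiv_comp_eq {F V : Type*} [Field F] [AddCommGroup V] [Module F V]
    [FiniteDimensional F V] {n : ℕ} {t t' : Fin n → V} (ht : LinearIndependent F t)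
    (ht' : LinearIndependent F t') : ∃ h : V ≃ₗ[F] V, ∀ i, h (t i) = t' i := by
  let f := ht.linearCombinationEquiv.symm ≪≫ₗ ht'.linearCombinationEquiv
  obtain ⟨g, hg⟩ := Submodule.exists_linearEquiv_restrict_eq f
  refine ⟨g, fun i => ?_⟩
  have h1 : (ht.linearCombinationEquiv (Finsupp.single i 1) : V) = t i := by simp
  rw [← h1, ← hg]
  simp [f]

variable {F : Type*} [Field F] {n ℓ : ℕ}

theorem linearIndependent_linearEquiv_comp_iff {V : Type*} [AddCommGroup V] [Module F V]
    (h : V ≃ₗ[F] V) {t : Fin n → V} :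
    LinearIndependent F (fun i => h (t i)) ↔ LinearIndependent F t :=
  LinearMap.linearIndependent_iff (h : V →ₗ[F] V) (LinearEquiv.ker h)

/-- The matrix `m a` is multiplication by `a` in the field with `q^ℓ` elements, restricted to the
span of the first `n` basis vectors. -/
theorem exists_regular_family [Finite F] (hn : 1 ≤ n) (hnℓ : n ≤ ℓ) :
    ∃ m : (Fin ℓ → F) → Fin n → Fin ℓ → F, m 0 = 0 ∧
      (∀ a, a ≠ 0 → LinearIndependent F (m a)) ∧
      ∀ u : Fin n → F, u ≠ 0 →
        Function.Bijective fun a => Fintype.linearCombination F (m a) u := by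
  obtain ⟨μ, h0, hμ, hμ'⟩ := exists_field_mul (F := F) (hn.trans hnℓ)
  have ht : LinearIndependent F fun i : Fin n => Pi.basisFun F (Fin ℓ) (Fin.castLE hnℓ i) :=
    (Pi.basisFun F (Fin ℓ)).linearIndependent.comp _ (Fin.castLE_injective hnℓ)
  refine ⟨fun a i => μ a (Pi.basisFun F (Fin ℓ) (Fin.castLE hnℓ i)), ?_, ?_, ?_⟩
  · ext i; simp [h0]
  · intro a ha
    exact ht.map' (μ a) (LinearMap.ker_eq_bot.2 (hμ' a ha).1)
  · intro u hu
    have hv : Fintype.linearCombination F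
        (fun i : Fin n => Pi.basisFun F (Fin ℓ) (Fin.castLE hnℓ i)) u ≠ 0 := fun h =>
      hu ((linearIndependent_iff_injective_fintypeLinearCombination.1 ht) (by simpa using h))
    convert hμ _ hv using 2 with a
    simp only [Fintype.linearCombination_apply, map_sum, map_smul]

theorem bijective_linearCombination_translate {m : (Fin ℓ → F) → Fin n → Fin ℓ → F}
    (B : Fin n → Fin ℓ → F) (h : (Fin ℓ → F) ≃ₗ[F] (Fin ℓ → F)) {u : Fin n → F}
    (hm : Function.Bijective fun a => Fintype.linearCombination F (m a) u) :
    Function.Bijective fun a => Fintype.linearCombination F (B + fun i => h (m a i)) u := by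
  have : (fun a => Fintype.linearCombination F (B + fun i => h (m a i)) u) =
      (fun v => Fintype.linearCombination F B u + h v) ∘
        fun a => Fintype.linearCombination F (m a) u := by
    funext a
    simp [Fintype.linearCombination_apply, smul_add, Finset.sum_add_distrib, map_sum]
  rw [this]
  exact ((AddGroup.addLeft_bijective _).comp h.bijective).comp hm

variable [Fintype F]

theorem sum_linearIndependent (hnℓ : n ≤ ℓ)
    [DecidablePred fun D : Fin n → Fin ℓ → F => LinearIndependent F D] :
    ∑ D : Fin n → Fin ℓ → F, (if LinearIndependent F D then (1 : ℝ) else 0) =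
      eigval F n ℓ 0 := by
  have h := card_linearIndependent (K := F) (V := Fin ℓ → F) (k := n) (by simpa using hnℓ)
  rw [Finset.sum_boole, ← Fintype.card_subtype, ← Nat.card_eq_fintype_card, h,
    eigval_zero_eq F hnℓ, Finset.prod_range, Nat.cast_prod]
  refine Finset.prod_congr rfl fun i _ => ?_
  rw [Nat.cast_sub (Nat.pow_le_pow_right Fintype.card_pos (by simp; omega)),
    Nat.card_eq_fintype_card]
  simp

/-- Averaging over the images of a regular family under `GL(ℓ, q)`. -/
theorem rankConv_of_sum_regular_family (hnℓ : n ≤ ℓ) {m : (Fin ℓ → F) → Fin n → Fin ℓ → F}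
    (hm0 : m 0 = 0) (hm : ∀ a, a ≠ 0 → LinearIndependent F (m a))
    {f : (Fin n → Fin ℓ → F) → ℝ} {x : ℝ} {B : Fin n → Fin ℓ → F}
    (hf : ∀ h : (Fin ℓ → F) ≃ₗ[F] (Fin ℓ → F), ∑ a, f (B + fun i => h (m a i)) = x) :
    ((Nat.card F : ℝ) ^ ℓ - 1) * rankConv f B = eigval F n ℓ 0 * (x - f B) := by
  classical
  let G := (Fin ℓ → F) ≃ₗ[F] (Fin ℓ → F)
  have : Finite G := DFunLike.finite G
  have : Fintype G := Fintype.ofFinite G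
  -- `GL(ℓ, q)` is transitive on independent `n`-tuples, so `Q` is constant on them. The sum of `Q
  -- (m a)` over `a` is then evaluated in two ways: through `hf`, and by separating `a = 0` from the
  -- `q^ℓ - 1` equal terms.
  let Q : (Fin n → Fin ℓ → F) → ℝ := fun t => ∑ h : G, f (B + fun i => h (t i))
  have hQ : ∀ t t', LinearIndependent F t → LinearIndependent F t' → Q t = Q t' := by
    intro t t' ht ht'
    obtain ⟨k, hk⟩ := exists_linearEquiv_comp_eq ht ht'
    have h1 := Equiv.sum_comp (Equiv.mulRight (k : (Fin ℓ → F) ≃ₗ[F] (Fin ℓ → F)))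
      (fun h : G => f (B + fun i => h (t i)))
    rw [show Q t = ∑ h : G, f (B + fun i => h (t i)) from rfl, ← h1]
    refine Finset.sum_congr rfl fun h _ => ?_
    change f (B + fun i => h (k (t i))) = _
    simp only [hk]
  have hG : (Fintype.card G : ℝ) ≠ 0 := by
    have : Nonempty G := ⟨LinearEquiv.refl F _⟩
    exact Nat.cast_ne_zero.2 Fintype.card_ne_zero
  -- Summing the constant `Q` over all `λ_0` independent tuples and exchanging the sums gives one
  -- copy of `rankConv f B` for each group element.
  have hcol : ∀ t, LinearIndependent F t →
      eigval F n ℓ 0 * Q t = Fintype.card G * rankConv f B := by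
    intro t ht
    rw [← sum_linearIndependent hnℓ, Finset.sum_mul]
    have h1 : ∀ D : Fin n → Fin ℓ → F, (if LinearIndependent F D then (1 : ℝ) else 0) * Q t =
        ∑ h : G, if LinearIndependent F D then f (B + fun i => h (D i)) else 0 := by
      intro D
      split_ifs with hD
      · rw [hQ t D ht hD, one_mul]
      · simp
    simp only [h1]
    rw [Finset.sum_comm]
    have h2 : ∀ h : G, (∑ D : Fin n → Fin ℓ → F,
        if LinearIndependent F D then f (B + fun i => h (D i)) else 0) = rankConv f B := by
      intro h
      rw [rankConv_eq_sum_add, ← Equiv.sum_comp (Equiv.piCongrRight fun _ : Fin n => h.toEquiv)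
        (fun D => if LinearIndependent F D then f (B + D) else 0)]
      refine Finset.sum_congr rfl fun D _ => ?_
      exact if_congr (linearIndependent_linearEquiv_comp_iff h).symm rfl rfl
    simp only [h2]
    simp
  have hrow : ∑ a : Fin ℓ → F, Q (m a) = Fintype.card G * x := by
    simp only [Q]
    rw [Finset.sum_comm]
    simp only [G] at hf ⊢
    simp [hf]
  have hQ0 : Q (m 0) = Fintype.card G * f B := by
    have h0 : ∀ h : G, (fun i => h ((0 : Fin n → Fin ℓ → F) i)) = 0 := fun h => by
      funext i; simp
    simp only [Q, hm0, h0, add_zero]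
    simp
  have hmain : Fintype.card G * (eigval F n ℓ 0 * x) = Fintype.card G *
      (eigval F n ℓ 0 * f B + ((Nat.card F : ℝ) ^ ℓ - 1) * rankConv f B) := by
    have h1 : ∑ a : Fin ℓ → F, eigval F n ℓ 0 * Q (m a) =
        eigval F n ℓ 0 * Q (m 0) + ((Nat.card F : ℝ) ^ ℓ - 1) *
          (Fintype.card G * rankConv f B) := by
      rw [Fintype.sum_eq_add_sum_compl 0]
      congr 1
      rw [Finset.sum_congr rfl fun a ha => hcol (m a) (hm a (by simpa using ha))]
      rw [Finset.sum_const, Finset.card_compl, Finset.card_singleton, nsmul_eq_mul,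
        Nat.cast_sub Fintype.card_pos]
      simp
    rw [← Finset.mul_sum, hrow, hQ0] at h1
    linarith
  have := mul_left_cancel₀ hG hmain
  linarith

end Averaging

/-! ### Translation between subspaces, matrices and vectors -/

section Transfer

variable {F : Type*} [Field F] {n ℓ : ℕ}

theorem charVec_graphEquiv (L : Set (Submodule F (Space F n ℓ))) (A : Fin n → Fin ℓ → F)
    [Decidable (rowGraph A ∈ L)] :
    charVec L (graphEquiv F n ℓ A) = if rowGraph A ∈ L then 1 else 0 := by
  by_cases h : rowGraph A ∈ L <;> simp [charVec, coe_graphEquiv, h]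

variable [Fintype F]

theorem mem_eigSpace_iff (hn : 1 ≤ n) (j : ℕ) (v : attenuated F n ℓ n → ℝ) :
    v ∈ eigSpace F n ℓ j ↔
      rankConv (v ∘ graphEquiv F n ℓ) = eigval F n ℓ j • (v ∘ graphEquiv F n ℓ) := by
  classical
  have hK : (kneserMatrix F n ℓ *ᵥ v) ∘ graphEquiv F n ℓ =
      rankConv (v ∘ graphEquiv F n ℓ) := by
    funext A
    simp only [Function.comp_apply, Matrix.mulVec, dotProduct, rankConv]
    rw [← (graphEquiv F n ℓ).sum_comp]
    refine Finset.sum_congr rfl fun B _ => ?_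
    have hadj : (kneserGraph F n ℓ).Adj (graphEquiv F n ℓ A) (graphEquiv F n ℓ B) ↔
        LinearIndependent F (B - A) := by
      rw [← disjoint_rowGraph_iff, ← coe_graphEquiv, ← coe_graphEquiv]
      -- Disjoint vertices are automatically distinct, because `n ≥ 1` excludes the zero space.
      refine ⟨fun h => h.2, fun h => ⟨?_, h⟩⟩
      intro heq
      rw [heq, disjoint_self, coe_graphEquiv] at h
      have := finrank_rowGraph B
      rw [h, finrank_bot] at this
      omega
    rw [kneserMatrix, SimpleGraph.adjMatrix_apply, ite_mul, one_mul, zero_mul]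
    exact if_congr hadj rfl rfl
  rw [eigSpace, Module.End.mem_eigenspace_iff, Matrix.mulVecLin_apply, ← hK]
  constructor
  · intro h
    rw [h]; rfl
  · intro h
    exact (graphEquiv F n ℓ).surjective.injective_comp_right h

/-- This is the row of `M g = 0` at the point spanned by `(u, w)`. -/
theorem sum_of_mem_ker_incMatrix {g : attenuated F n ℓ n → ℝ} [DecidableEq F]
    (hg : incMatrix F n ℓ *ᵥ g = 0) (u : Fin n → F) (w : Fin ℓ → F) (hu : u ≠ 0) :
    ∑ A : Fin n → Fin ℓ → F, (if ∑ i, u i • A i = w then g (graphEquiv F n ℓ A) else 0) = 0 := by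
  classical
  have h := congrFun hg ⟨_, span_append_mem_attenuated hu w⟩
  rw [Matrix.mulVec, dotProduct, ← (graphEquiv F n ℓ).sum_comp] at h
  refine Eq.trans ?_ h
  refine Finset.sum_congr rfl fun A _ => ?_
  rw [incMatrix, ite_mul, one_mul, zero_mul]
  refine if_congr ?_ rfl rfl
  rw [coe_graphEquiv, Submodule.span_singleton_le_iff_mem, append_mem_rowGraph]
  rfl

open Classical in
theorem ncard_eq_sum_rowGraph {L : Set (Submodule F (Space F n ℓ))}
    (hL : L ⊆ attenuated F n ℓ n) :
    (L.ncard : ℝ) = ∑ A : Fin n → Fin ℓ → F, if rowGraph A ∈ L then 1 else 0 := by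
  have h : L = rowGraph '' {A : Fin n → Fin ℓ → F | rowGraph A ∈ L} := by
    ext P
    constructor
    · intro hP
      obtain ⟨A, rfl⟩ := exists_rowGraph_eq (hL hP)
      exact ⟨A, hP, rfl⟩
    · rintro ⟨A, hA, rfl⟩
      exact hA
  rw [Finset.sum_boole]
  conv_lhs => rw [h]
  rw [Set.ncard_image_of_injective _ rowGraph_injective, Set.ncard_eq_toFinset_card']
  simp

theorem charVec_dotProduct_charVec {L R : Set (Submodule F (Space F n ℓ))}
    (hL : L ⊆ attenuated F n ℓ n) :
    charVec R ⬝ᵥ charVec L = ((L ∩ R).ncard : ℝ) := by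
  classical
  rw [ncard_eq_sum_rowGraph (Set.inter_subset_left.trans hL), dotProduct,
    ← (graphEquiv F n ℓ).sum_comp]
  refine Finset.sum_congr rfl fun A _ => ?_
  simp only [charVec_graphEquiv, Set.mem_inter_iff]
  split_ifs <;> simp_all

theorem ncard_inter_range_rowGraph {L : Set (Submodule F (Space F n ℓ))}
    (hL : L ⊆ attenuated F n ℓ n) {ι : Type*} [Fintype ι] {t : ι → Fin n → Fin ℓ → F}
    (ht : Function.Injective t) :
    ((L ∩ Set.range fun a => rowGraph (t a)).ncard : ℝ) =
      ∑ a, charVec L (graphEquiv F n ℓ (t a)) := by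
  classical
  rw [ncard_eq_sum_rowGraph (Set.inter_subset_left.trans hL)]
  simp only [charVec_graphEquiv]
  rw [← Finset.sum_image (s := Finset.univ) (g := t)
    (f := fun A => if rowGraph A ∈ L then (1 : ℝ) else 0) ht.injOn]
  rw [← Finset.sum_filter_add_sum_filter_not Finset.univ (· ∈ Finset.univ.image t)]
  rw [Finset.filter_univ_mem, Finset.sum_eq_zero (s := Finset.univ.filter _), add_zero]
  · refine Finset.sum_congr rfl fun A hA => ?_
    obtain ⟨a, -, rfl⟩ := Finset.mem_image.1 hA
    simp
  · intro A hA
    refine if_neg fun h => ?_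
    obtain ⟨a, ha⟩ := h.2
    have := rowGraph_injective ha
    simp at hA
    exact hA a this

theorem incMatrix_mulVec_charVec {S R : Set (Submodule F (Space F n ℓ))} (hnℓ : n ≤ ℓ)
    (hS : IsAttenuatedSpread S) (hR : R ⊆ S) (τ : attenuated F n ℓ 1)
    [Decidable ((τ : Submodule F (Space F n ℓ)) ∈ coveredPoints R)] :
    (incMatrix F n ℓ *ᵥ charVec R) τ =
      if (τ : Submodule F (Space F n ℓ)) ∈ coveredPoints R then 1 else 0 := by
  classical
  rw [Matrix.mulVec, dotProduct]
  split_ifs with h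
  · obtain ⟨-, ρ, hρ, hτ⟩ := h
    rw [Finset.sum_eq_single ⟨ρ, hS.subset_attenuated hnℓ (hR hρ)⟩]
    · simp [incMatrix, charVec, hρ, hτ]
    · intro π _ hπ
      by_contra h0
      simp only [incMatrix, charVec, mul_ite, mul_one, mul_zero, ite_eq_right_iff,
        one_ne_zero, imp_false, not_forall, not_not] at h0
      obtain ⟨h1, h2⟩ := h0
      exact hπ (Subtype.ext ((hS.existsUnique τ.2).unique ⟨hR h1, h2⟩ ⟨hR hρ, hτ⟩))
    · simp
  · refine Finset.sum_eq_zero fun π _ => ?_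
    by_contra h0
    simp only [incMatrix, charVec, mul_ite, mul_one, mul_zero, ite_eq_right_iff,
      one_ne_zero, imp_false, not_forall, not_not] at h0
    obtain ⟨h1, h2⟩ := h0
    exact h ⟨τ.2, π, h1, h2⟩

/-- The functional `u ↦ w ⬝ᵥ u` kills `ker M`, hence factors through `M`; the coordinates of the
factor give a preimage of `w` under the transpose. -/
theorem orthCompl_ker_le_range_transpose {ι κ : Type*} [Fintype ι] [Fintype κ]
    (M : Matrix κ ι ℝ) :
    orthCompl (LinearMap.ker M.mulVecLin) ≤ LinearMap.range M.transpose.mulVecLin := by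
  classical
  intro w hw
  have hmem : dotProductBilin ℝ ℝ w ∈ (LinearMap.ker M.mulVecLin).dualAnnihilator := by
    rw [Submodule.mem_dualAnnihilator]
    intro u hu
    rw [dotProductBilin_apply_apply, dotProduct_comm]
    exact hw u hu
  rw [← LinearMap.range_dualMap_eq_dualAnnihilator_ker] at hmem
  obtain ⟨z, hz⟩ := hmem
  refine ⟨fun τ => z (Pi.single τ 1), ?_⟩
  funext π
  have h1 := DFunLike.congr_fun hz (Pi.single π 1)
  rw [LinearMap.dualMap_apply, Matrix.mulVecLin_apply, Matrix.mulVec_single_one,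
    dotProductBilin_apply_apply, dotProduct_single_one, LinearMap.pi_apply_eq_sum_univ z] at h1
  rw [Matrix.mulVecLin_apply, ← h1, Matrix.mulVec, dotProduct]
  refine Finset.sum_congr rfl fun τ _ => ?_
  simp only [Matrix.transpose_apply, Matrix.col_apply, smul_eq_mul]
  congr 2
  funext k
  simp [Pi.single_apply, eq_comm]

end Transfer

/-! ### The individual implications -/

section Equivalences

variable {F : Type*} [Field F] [Fintype F] {n ℓ : ℕ}

theorem range_transpose_le_orthCompl_ker {ι κ : Type*} [Fintype ι] [Fintype κ]
    (M : Matrix κ ι ℝ) :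
    LinearMap.range M.transpose.mulVecLin ≤ orthCompl (LinearMap.ker M.mulVecLin) := by
  rintro _ ⟨y, rfl⟩ u hu
  rw [LinearMap.mem_ker, Matrix.mulVecLin_apply] at hu
  rw [Matrix.mulVecLin_apply, Matrix.dotProduct_mulVec, Matrix.vecMul_transpose, hu,
    zero_dotProduct]

theorem eigSpace_sup_le_orthCompl_ker (hn : 1 ≤ n) (hnℓ : n ≤ ℓ) :
    eigSpace F n ℓ 0 ⊔ eigSpace F n ℓ 1 ≤
      orthCompl (LinearMap.ker (incMatrix F n ℓ).mulVecLin) := by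
  classical
  have key : ∀ j, j = 0 ∨ j = 1 → eigSpace F n ℓ j ≤
      orthCompl (LinearMap.ker (incMatrix F n ℓ).mulVecLin) := by
    intro j hj v hv u hu
    rw [mem_eigSpace_iff hn] at hv
    rw [LinearMap.mem_ker, Matrix.mulVecLin_apply] at hu
    rw [dotProduct, ← (graphEquiv F n ℓ).sum_comp]
    refine sum_mul_eq_zero_of_rankConv_eq (v := v ∘ graphEquiv F n ℓ)
      (g := u ∘ graphEquiv F n ℓ) hn hnℓ (sum_of_mem_ker_incMatrix hu) ?_ hv
    rcases hj with rfl | rfl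
    · exact Or.inl rfl
    · exact Or.inr rfl
  exact sup_le (key 0 (Or.inl rfl)) (key 1 (Or.inr rfl))

theorem rankConv_const (hnℓ : n ≤ ℓ) (c : ℝ) :
    rankConv (fun _ : Fin n → Fin ℓ → F => c) = fun _ => eigval F n ℓ 0 * c := by
  classical
  funext A
  rw [rankConv_eq_sum_add, ← sum_linearIndependent hnℓ, Finset.sum_mul]
  exact Finset.sum_congr rfl fun D _ => by split_ifs <;> simp

theorem one_mem_eigSpace (hn : 1 ≤ n) (hnℓ : n ≤ ℓ) :
    (1 : attenuated F n ℓ n → ℝ) ∈ eigSpace F n ℓ 0 := by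
  rw [mem_eigSpace_iff hn]
  refine (rankConv_const hnℓ 1).trans ?_
  funext A
  simp

theorem rankConv_sub (f g : (Fin n → Fin ℓ → F) → ℝ) :
    rankConv (f - g) = rankConv f - rankConv g := by
  funext A
  simp only [rankConv, Pi.sub_apply, ← Finset.sum_sub_distrib]
  exact Finset.sum_congr rfl fun D _ => by split_ifs <;> simp

variable {L : Set (Submodule F (Space F n ℓ))}

theorem ncard_disjoint_eq_rankConv (hL : L ⊆ attenuated F n ℓ n) (A : Fin n → Fin ℓ → F) :
    (({σ ∈ L | Disjoint σ (rowGraph A)}.ncard : ℕ) : ℝ) =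
      rankConv (charVec L ∘ graphEquiv F n ℓ) A := by
  classical
  rw [ncard_eq_sum_rowGraph ((Set.sep_subset _ _).trans hL), rankConv]
  refine Finset.sum_congr rfl fun B _ => ?_
  have h : Disjoint (rowGraph B) (rowGraph A) ↔ LinearIndependent F (B - A) := by
    rw [disjoint_comm, disjoint_rowGraph_iff]
  simp only [Set.mem_sep_iff, h, Function.comp_apply, charVec_graphEquiv]
  split_ifs <;> simp_all

theorem sub_mul_prod_eq_neg_eigval_one_mul (F : Type*) (n ℓ : ℕ) (x y : ℝ) :
    (x - y) * (Nat.card F : ℝ) ^ n.choose 2 *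
        ∏ s ∈ Finset.Icc 1 (n - 1), ((Nat.card F : ℝ) ^ (ℓ - n + s) - 1) =
      -(eigval F n ℓ 1 * (x - y)) := by
  rw [eigval]; ring

theorem one_lt_card_pow (hℓ : 1 ≤ ℓ) : (1 : ℝ) < (Nat.card F : ℝ) ^ ℓ :=
  one_lt_pow₀ (by exact_mod_cast Finite.one_lt_card (α := F)) (by omega)

/-- The spreads used are the `GL(ℓ, q)`-images of the regular family, translated so that `a = 0`
gives `π` itself. -/
theorem ncard_disjoint_of_ncard_inter_spread (hn : 1 ≤ n) (hnℓ : n ≤ ℓ)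
    (hL : L ⊆ attenuated F n ℓ n) {x : ℤ}
    (h : ∀ S : Set (Submodule F (Space F n ℓ)), IsAttenuatedSpread S →
      ((L ∩ S).ncard : ℤ) = x) (π : attenuated F n ℓ n) :
    (({σ ∈ L | Disjoint σ (π : Submodule F (Space F n ℓ))}.ncard : ℕ) : ℝ) =
      ((x : ℝ) - charVec L π) * (Nat.card F : ℝ) ^ n.choose 2 *
        ∏ s ∈ Finset.Icc 1 (n - 1), ((Nat.card F : ℝ) ^ (ℓ - n + s) - 1) := by
  obtain ⟨B, rfl⟩ := (graphEquiv F n ℓ).surjective π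
  obtain ⟨m, hm0, hm, hmu⟩ := exists_regular_family (F := F) hn hnℓ
  have hsum : ∀ k : (Fin ℓ → F) ≃ₗ[F] (Fin ℓ → F),
      ∑ a, (charVec L ∘ graphEquiv F n ℓ) (B + fun i => k (m a i)) = (x : ℝ) := by
    intro k
    have hbij := fun u hu => bijective_linearCombination_translate B k (hmu u hu)
    have hinj : Function.Injective fun a => B + fun i => k (m a i) := by
      have hu : (fun _ => 1 : Fin n → F) ≠ 0 := fun h => one_ne_zero (congrFun h ⟨0, hn⟩)
      exact fun a b hab => (hbij _ hu).1 (congrArg (Fintype.linearCombination F · _) hab)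
    have h1 := ncard_inter_range_rowGraph hL hinj
    have h2 := h _ (isAttenuatedSpread_range_rowGraph hn hnℓ hbij)
    rw [← h2, Int.cast_natCast, h1]
    rfl
  have h1 := rankConv_of_sum_regular_family hnℓ hm0 hm hsum
  rw [sub_mul_prod_eq_neg_eigval_one_mul, coe_graphEquiv, ncard_disjoint_eq_rankConv hL]
  rw [eigval_zero_eq_mul_eigval_one F hn hnℓ] at h1
  have hq := one_lt_card_pow (F := F) (hn.trans hnℓ)
  refine mul_left_cancel₀ (sub_pos.2 hq).ne' (h1.trans ?_)
  simp only [Function.comp_apply]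
  ring

/-- The hypothesis reads `K χ = λ_1 (χ - x j)`. Since `K j = λ_0 j` and `λ_0 = -(q^ℓ - 1) λ_1`, the
shift `x / q^ℓ` absorbs the constant. -/
theorem charVec_sub_mem_eigSpace_one (hn : 1 ≤ n) (hnℓ : n ≤ ℓ)
    (hL : L ⊆ attenuated F n ℓ n) {x : ℝ}
    (h : ∀ π : attenuated F n ℓ n,
      (({σ ∈ L | Disjoint σ (π : Submodule F (Space F n ℓ))}.ncard : ℕ) : ℝ) =
      (x - charVec L π) * (Nat.card F : ℝ) ^ n.choose 2 *
        ∏ s ∈ Finset.Icc 1 (n - 1), ((Nat.card F : ℝ) ^ (ℓ - n + s) - 1)) :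
    charVec L - (x / (Nat.card F : ℝ) ^ ℓ) • (1 : attenuated F n ℓ n → ℝ) ∈
      eigSpace F n ℓ 1 := by
  rw [mem_eigSpace_iff hn]
  have h1 : (charVec L - (x / (Nat.card F : ℝ) ^ ℓ) • (1 : attenuated F n ℓ n → ℝ)) ∘
      graphEquiv F n ℓ = charVec L ∘ graphEquiv F n ℓ - fun _ => x / (Nat.card F : ℝ) ^ ℓ := by
    funext A; simp
  rw [h1, rankConv_sub, rankConv_const hnℓ]
  funext A
  have h2 := h (graphEquiv F n ℓ A)
  rw [sub_mul_prod_eq_neg_eigval_one_mul, coe_graphEquiv, ncard_disjoint_eq_rankConv hL] at h2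
  simp only [Pi.sub_apply, Pi.smul_apply, smul_eq_mul, h2, Function.comp_apply]
  rw [eigval_zero_eq_mul_eigval_one F hn hnℓ]
  have hq := one_lt_card_pow (F := F) (hn.trans hnℓ)
  field_simp
  ring

theorem charVec_mem_eigSpace_sup (hn : 1 ≤ n) (hnℓ : n ≤ ℓ) {c : ℝ}
    (h : charVec L - c • (1 : attenuated F n ℓ n → ℝ) ∈ eigSpace F n ℓ 1) :
    charVec L ∈ eigSpace F n ℓ 0 ⊔ eigSpace F n ℓ 1 := by
  have h0 := Submodule.smul_mem _ c (one_mem_eigSpace (F := F) hn hnℓ)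
  rw [← add_sub_cancel (c • (1 : attenuated F n ℓ n → ℝ)) (charVec L)]
  exact Submodule.add_mem_sup h0 h

/-- Inside a spread each point is covered at most once, so `M χ_R` is the indicator of the covered
points and `χ_R - χ_R'` lies in `ker M`. -/
theorem ncard_inter_eq_of_conjugate (hnℓ : n ≤ ℓ) (hL : L ⊆ attenuated F n ℓ n)
    (h : charVec L ∈ orthCompl (LinearMap.ker (incMatrix F n ℓ).mulVecLin))
    {R R' : Set (Submodule F (Space F n ℓ))} (hR : AreConjugateSwitchingSets R R') :
    (L ∩ R).ncard = (L ∩ R').ncard := by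
  classical
  obtain ⟨⟨S, hS, hRS⟩, ⟨S', hS', hRS'⟩, -, hcov⟩ := hR
  have hker : charVec R - charVec R' ∈ LinearMap.ker (incMatrix F n ℓ).mulVecLin := by
    rw [LinearMap.mem_ker, Matrix.mulVecLin_apply, Matrix.mulVec_sub]
    funext τ
    rw [Pi.sub_apply, incMatrix_mulVec_charVec hnℓ hS hRS,
      incMatrix_mulVec_charVec hnℓ hS' hRS', hcov, sub_self, Pi.zero_apply]
  have h1 := h _ hker
  rw [sub_dotProduct, charVec_dotProduct_charVec hL, charVec_dotProduct_charVec hL,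
    sub_eq_zero] at h1
  exact_mod_cast h1

theorem ncard_inter_spread_of_conjugate (hn : 1 ≤ n) (hnℓ : n ≤ ℓ)
    (hL : L ⊆ attenuated F n ℓ n) {x : ℤ}
    (hx : (L.ncard : ℤ) = x * (Nat.card F : ℤ) ^ ((n - 1) * ℓ))
    (h : ∀ R R' : Set (Submodule F (Space F n ℓ)), AreConjugateSwitchingSets R R' →
      (L ∩ R).ncard = (L ∩ R').ncard)
    {S : Set (Submodule F (Space F n ℓ))} (hS : IsAttenuatedSpread S) :
    ((L ∩ S).ncard : ℤ) = x := by
  classical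
  have hfin : L.Finite := Set.toFinite L
  have hconst : ∀ S', IsAttenuatedSpread S' → (L ∩ S').ncard = (L ∩ S).ncard := by
    intro S' hS'
    have h1 := h _ _ (areConjugateSwitchingSets_sdiff hS hS')
    have e : ∀ A B : Set (Submodule F (Space F n ℓ)),
        (L ∩ A).ncard = (L ∩ (A ∩ B)).ncard + (L ∩ (A \ B)).ncard := by
      intro A B
      rw [← Set.ncard_inter_add_ncard_sdiff_eq_ncard (L ∩ A) B (hfin.inter_of_left A),
        Set.inter_assoc, Set.inter_sdiff_assoc]
    rw [e S S', e S' S, h1, Set.inter_comm S S']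
  obtain ⟨m, -, -, hmu⟩ := exists_regular_family (F := F) hn hnℓ
  have hB : ∀ B : Fin n → Fin ℓ → F,
      ((L ∩ S).ncard : ℝ) = ∑ a, charVec L (graphEquiv F n ℓ (B + m a)) := by
    intro B
    have hbij := fun u hu => bijective_linearCombination_translate B
      (LinearEquiv.refl F (Fin ℓ → F)) (hmu u hu)
    have hinj : Function.Injective fun a => B + m a := by
      have hu : (fun _ => 1 : Fin n → F) ≠ 0 := fun h => one_ne_zero (congrFun h ⟨0, hn⟩)
      exact fun a b hab => (hmu _ hu).1
        (congrArg (Fintype.linearCombination F · _) (add_left_cancel hab))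
    rw [← hconst _ (isAttenuatedSpread_range_rowGraph hn hnℓ hbij)]
    exact ncard_inter_range_rowGraph hL hinj
  -- Double counting over all translates: for fixed `a`, the matrix `B + m a` runs over all matrices
  -- once, so `q^(nℓ) |L ∩ S| = q^ℓ |L|`.
  have hsum : ∑ _B : Fin n → Fin ℓ → F, ((L ∩ S).ncard : ℝ) =
      ∑ _a : Fin ℓ → F, (L.ncard : ℝ) := by
    rw [Finset.sum_congr rfl fun B _ => hB B, Finset.sum_comm]
    refine Finset.sum_congr rfl fun a _ => ?_
    rw [ncard_eq_sum_rowGraph hL, ← Equiv.sum_comp (Equiv.addRight (m a))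
      (fun A => if rowGraph A ∈ L then (1 : ℝ) else 0)]
    exact Finset.sum_congr rfl fun B _ => charVec_graphEquiv L _
  simp only [Finset.sum_const, Finset.card_univ, Fintype.card_pi, Fintype.card_fin,
    Finset.prod_const, nsmul_eq_mul] at hsum
  have hsum' : ((Fintype.card F ^ ℓ) ^ n : ℤ) * (L ∩ S).ncard =
      (Fintype.card F ^ ℓ : ℤ) * L.ncard := by exact_mod_cast hsum
  rw [hx, Nat.card_eq_fintype_card] at hsum'
  have hq : ((Fintype.card F : ℤ) ^ ℓ) ^ n ≠ 0 := by
    have : (Fintype.card F : ℤ) ≠ 0 := Nat.cast_ne_zero.2 Fintype.card_ne_zero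
    positivity
  refine mul_left_cancel₀ hq (hsum'.trans ?_)
  obtain ⟨k, rfl⟩ := Nat.exists_eq_add_of_le' hn
  rw [Nat.add_sub_cancel, mul_comm k ℓ, pow_mul, pow_succ]
  ring

end Equivalences

end

end CameronLiebler

open CameronLiebler in
theorem mainTheorem1 (F : Type*) [Field F] [Finite F] (n ℓ : ℕ) (hn : 1 ≤ n) (hnℓ : n ≤ ℓ)
    (L : Set (Submodule F (Space F n ℓ))) (hL : L ⊆ attenuated F n ℓ n) (hne : L.Nonempty)
    (x : ℤ) (hx : (L.ncard : ℤ) = x * (Nat.card F : ℤ) ^ ((n - 1) * ℓ)) :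
    [
      charVec L ∈ LinearMap.range (incMatrix F n ℓ).transpose.mulVecLin,
      charVec L ∈ orthCompl (LinearMap.ker (incMatrix F n ℓ).mulVecLin),
      ∀ π : attenuated F n ℓ n,
        (({σ ∈ L | Disjoint σ (π : Submodule F (Space F n ℓ))}.ncard : ℕ) : ℝ) =
          ((x : ℝ) - charVec L π) * (Nat.card F : ℝ) ^ n.choose 2 *
            ∏ s ∈ Finset.Icc 1 (n - 1), ((Nat.card F : ℝ) ^ (ℓ - n + s) - 1),
      charVec L - ((x : ℝ) / (Nat.card F : ℝ) ^ ℓ) • (1 : attenuated F n ℓ n → ℝ) ∈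
        eigSpace F n ℓ 1,
      charVec L ∈ eigSpace F n ℓ 0 ⊔ eigSpace F n ℓ 1,
      ∀ S : Set (Submodule F (Space F n ℓ)), IsAttenuatedSpread S →
        ((L ∩ S).ncard : ℤ) = x,
      ∀ R R' : Set (Submodule F (Space F n ℓ)), AreConjugateSwitchingSets R R' →
        (L ∩ R).ncard = (L ∩ R').ncard ].TFAE := by
  have := Fintype.ofFinite F
  tfae_have 1 → 2 := fun h => range_transpose_le_orthCompl_ker _ h
  tfae_have 2 → 1 := fun h => orthCompl_ker_le_range_transpose _ h
  tfae_have 2 → 7 := fun h R R' hR => ncard_inter_eq_of_conjugate hnℓ hL h hR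
  tfae_have 7 → 6 := fun h S hS => ncard_inter_spread_of_conjugate hn hnℓ hL hx h hS
  tfae_have 6 → 3 := fun h => ncard_disjoint_of_ncard_inter_spread hn hnℓ hL h
  tfae_have 3 → 4 := fun h => charVec_sub_mem_eigSpace_one hn hnℓ hL h
  tfae_have 4 → 5 := fun h => charVec_mem_eigSpace_sup hn hnℓ h
  tfae_have 5 → 2 := fun h => eigSpace_sup_le_orthCompl_ker hn hnℓ h
  tfae_finish
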